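/- Let $k$ be an algebraically closed field and $n\ge 1$. Let $\mathfrak U_n$ be the chain $a_n<\dots<a_1<b_1<\dots<b_n$ with the equivalence classes $z_i=\{a_i,b_i\}$, $1\le i\le n$. A representation $V=(V_0,V_z)_z$ of $\mathfrak U_n$ consists of a finite-dimensional $k$-vector space $V_0$ and, for each class $z$, a subspace $V_z$ of the space $V_0^z$ of functions $z\to V_0$ (written as pairs $(h(a_i),h(b_i))$ for $z=z_i$), such that whenever $y<x$ and $h\in V_{[y]}$, the function on $[x]$ with value $h(y)$ at $x$ and $0$ elsewhere lies in $V_{[x]}$; here $[x]$ denotes the class of $x$. A morphism $V\to W$ is a linear map $\varphi:V_0\to W_0$ with $\varphi\circ h\in W_z$ for all $z$ and all $h\in V_z$. This gives the category $\mathrm{rep}(\mathfrak U_n)$. Its $\varepsilon$-sequences are the pairs of morphisms $U\to E\to W$ for which $0\to U_0\to E_0\to W_0\to 0$ and all $0\to U_z\to E_z\to W_z\to 0$ are exact; the first morphism of an $\varepsilon$-sequence is called an $\varepsilon$-inflation and the second an $\varepsilon$-deflation. Projectives are taken with respect to $\varepsilon$-deflations and injectives with respect to $\varepsilon$-inflations.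 An almost split sequence is an $\varepsilon$-sequence whose first morphism is left almost split and whose second morphism is right almost split. For $1\le i\le n$ consider the following representations, where $j$ runs through $1,\dots,n$: - $\mathcal L_{1,i}$, on $ke$: $V_{z_j}=0$ for $j<i$, and $V_{z_j}=\langle(0,e)\rangle$ for $j\ge i$; - $\mathcal L_{2,i}$, on $ke$: $V_{z_j}=\langle(0,e),(e,0)\rangle$ for $j\le i$, and $V_{z_j}=\langle(0,e)\rangle$ for $j>i$; - $\mathcal L_{3,i}$, on $ke_1\oplus ke_2$: $V_{z_j}=\langle(0,e_1),(e_1,0)\rangle$ for $j<i$, $V_{z_i}=\langle(0,e_1),(e_1,e_2)\rangle$, and $V_{z_j}=\langle(0,e_1),(0,e_2)\rangle$ for $j>i$. Let $S$ be the representation on $k$ with $V_z=0$ for all $z$. Then: 1. The representations $\mathcal L_{3,r}$ ($1\le r\le n$) and $S$ form a set of representatives of the isomorphism classes of indecomposable projectives of $\mathrm{rep}(\mathfrak U_n)$. 2. The representations $\mathcal L_{3,r}$ ($1\le r\le n$) and $\mathcal L_{2,n}$ form a set of representatives of the isomorphism classes of indecomposable injectives. 3. The following sequences are almost split, and every almost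 split sequence of $\mathrm{rep}(\mathfrak U_n)$ is isomorphic to one of them: $$\mathcal L_{1,1}\xrightarrow{(1,0)^t}\mathcal L_{3,1}\xrightarrow{(0,1)}\mathcal L_{1,1},\qquad S\xrightarrow{(0,1)^t}\mathcal L_{3,n}\xrightarrow{(1,0)}\mathcal L_{2,n},$$ $$\mathcal L_{1,i}\xrightarrow{(0,1)^t}\mathcal L_{3,i-1}\xrightarrow{(1,0)}\mathcal L_{2,i-1}\quad(2\le i\le n),\qquad \mathcal L_{2,i}\xrightarrow{(1,0)^t}\mathcal L_{3,i+1}\xrightarrow{(0,1)}\mathcal L_{1,i+1}\quad(1\le i\le n-1).$$ Here $(1,0)^t$ is $e\mapsto e_1$; $(0,1)^t$ is $e\mapsto e_2$ (for $S$: $1\mapsto e_2$); $(1,0)$ is $e_1\mapsto e,\ e_2\mapsto 0$; and $(0,1)$ is $e_1\mapsto 0,\ e_2\mapsto e$. 4. Consequently the Auslander–Reiten quiver of $\mathrm{rep}(\mathfrak U_n)$ is as follows. - The representations $S,\mathcal L_{1,i},\mathcal L_{2,i},\mathcal L_{3,i}$ ($1\le i\le n$) are pairwise non-isomorphic representatives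 of all the indecomposables; they are the vertices. - The number $\dim_k \mathrm{rad}(X,Y)/\mathrm{rad}^2(X,Y)$ of arrows from the vertex $X$ to the vertex $Y$ is $1$ for the pairs $\mathcal L_{1,1}\to\mathcal L_{3,1}$; $\mathcal L_{1,i+1}\to\mathcal L_{3,i}$ and $\mathcal L_{2,i}\to\mathcal L_{3,i+1}$ ($1\le i\le n-1$); $S\to\mathcal L_{3,n}$; $\mathcal L_{3,i}\to\mathcal L_{1,i}$ and $\mathcal L_{3,i}\to\mathcal L_{2,i}$ ($1\le i\le n$). It is $0$ for all other pairs. - There is an almost split sequence starting at the vertex $X$ and ending at the vertex $Y$, i.e. $X=\tau Y$, exactly when $\mathcal L_{1,1}=\tau\mathcal L_{1,1}$, $\mathcal L_{2,i}=\tau\mathcal L_{1,i+1}$, $\mathcal L_{1,i+1}=\tau\mathcal L_{2,i}$ ($1\le i\le n-1$), or $S=\tau\mathcal L_{2,n}$. -/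

import Mathlib

open CategoryTheory CategoryTheory.Limits

universe u w

/-! # Posets with an involution -/

/-- A poset with an involution: a poset `Pt` with an equivalence relation all of whose classes
have at most two elements. The relation is given by its set of classes `Θ` together with the
surjection `cls` sending a point `x` to its class `[x]`. -/
structure InvPoset : Type (w + 1) where
  Pt : Type w
  [order : PartialOrder Pt]
  Θ : Type w
  cls : Pt → Θ
  cls_surj : Function.Surjective cls
  card_le_two : ∀ z : Θ, {x : Pt | cls x = z}.encard ≤ 2

attribute [instance] InvPoset.order

namespace InvPoset

/-- The equivalence class `z ∈ θ`, as a type. -/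
abbrev Cls (P : InvPoset.{w}) (z : P.Θ) : Type w := {x : P.Pt // P.cls x = z}

/-- A point `x`, as an element of its class `[x]`. -/
abbrev self (P : InvPoset.{w}) (x : P.Pt) : P.Cls (P.cls x) := ⟨x, rfl⟩

variable {k : Type u} [Field k] {M : Type u} [AddCommGroup M] [Module k M]

open Classical in
/-- `V_x⁻ = {v | i_x(v) ∈ V}`, where `i_x(v)` is the function on `[x]` with value `v` at `x`
and `0` elsewhere. -/
noncomputable def minus (P : InvPoset.{w}) (x : P.Pt) (V : Submodule k (P.Cls (P.cls x) → M)) :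
    Submodule k M :=
  V.comap (LinearMap.single k (fun _ : P.Cls (P.cls x) => M) (P.self x))

/-- `V_x⁺ = {h(x) | h ∈ V}`. -/
def plus (P : InvPoset.{w}) (x : P.Pt) (V : Submodule k (P.Cls (P.cls x) → M)) :
    Submodule k M :=
  V.map (LinearMap.proj (φ := fun _ : P.Cls (P.cls x) => M) (P.self x))

end InvPoset

/-! # The category of representations -/

/-- A vector space representation of a poset with an involution over the field `k`. -/
structure InvRep (k : Type u) [Field k] (P : InvPoset.{w}) : Type (max (u + 1) w) where
  V₀ : Type u
  [addCommGroup : AddCommGroup V₀]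
  [module : Module k V₀]
  [finite : FiniteDimensional k V₀]
  sub : ∀ z : P.Θ, Submodule k (P.Cls z → V₀)
  plus_le_minus : ∀ x y : P.Pt, y < x →
    P.plus y (sub (P.cls y)) ≤ P.minus x (sub (P.cls x))

attribute [instance] InvRep.addCommGroup InvRep.module InvRep.finite

namespace InvRep

variable {k : Type u} [Field k] {P : InvPoset.{w}}

/-- The space of morphisms `V ⟶ W`: linear maps `φ : V₀ → W₀` with `φ^z (V_z) ⊆ W_z`, where
`φ^z h = φ ∘ h`. -/
def homSub (V W : InvRep k P) : Submodule k (V.V₀ →ₗ[k] W.V₀) where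
  carrier := {φ | ∀ z, ∀ h ∈ V.sub z, φ.compLeft (P.Cls z) h ∈ W.sub z}
  add_mem' := fun hφ hψ z h hh => (W.sub z).add_mem (hφ z h hh) (hψ z h hh)
  zero_mem' := fun z _ _ => (W.sub z).zero_mem
  smul_mem' := fun c _ hφ z h hh => (W.sub z).smul_mem c (hφ z h hh)

instance : Category.{u} (InvRep k P) where
  Hom V W := homSub V W
  id V := ⟨LinearMap.id, fun _ _ hh => hh⟩
  comp f g := ⟨g.1 ∘ₗ f.1, fun z h hh => g.2 z _ (f.2 z h hh)⟩

/-- The linear map underlying a morphism. -/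
def lin {V W : InvRep k P} (f : V ⟶ W) : V.V₀ →ₗ[k] W.V₀ := f.1

/-- The linear map `V_z → W_z` induced by a morphism. -/
def onClass {V W : InvRep k P} (f : V ⟶ W) (z : P.Θ) : V.sub z →ₗ[k] W.sub z :=
  ((lin f).compLeft (P.Cls z)).restrict (f.2 z)

instance : Preadditive (InvRep k P) where
  homGroup V W := inferInstanceAs (AddCommGroup (homSub V W))
  add_comp _ _ _ f f' g := Subtype.ext (LinearMap.comp_add f.1 f'.1 g.1)
  comp_add _ _ _ f g g' := Subtype.ext (LinearMap.add_comp f.1 g'.1 g.1)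

instance : Linear k (InvRep k P) where
  homModule V W := inferInstanceAs (Module k (homSub V W))
  smul_comp _ _ _ r f g := Subtype.ext (LinearMap.comp_smul g.1 r f.1)
  comp_smul _ _ _ f r g := Subtype.ext (LinearMap.smul_comp r g.1 f.1)

/-- The direct sum `(V₀ ⊕ W₀, V_z ⊕ W_z)`. -/
def directSum (V W : InvRep k P) : InvRep k P where
  V₀ := V.V₀ × W.V₀
  sub z := (V.sub z).comap ((LinearMap.fst k V.V₀ W.V₀).compLeft (P.Cls z)) ⊓
    (W.sub z).comap ((LinearMap.snd k V.V₀ W.V₀).compLeft (P.Cls z))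
  plus_le_minus := by
    classical
    rintro x y hyx _ ⟨h, ⟨hV, hW⟩, rfl⟩
    have h1 : (Pi.single (P.self x) (h (P.self y)).1 : P.Cls (P.cls x) → V.V₀) ∈
        V.sub (P.cls x) := V.plus_le_minus x y hyx ⟨_, hV, rfl⟩
    have h2 : (Pi.single (P.self x) (h (P.self y)).2 : P.Cls (P.cls x) → W.V₀) ∈
        W.sub (P.cls x) := W.plus_le_minus x y hyx ⟨_, hW, rfl⟩
    refine ⟨?_, ?_⟩
    · refine Submodule.mem_comap.2 ?_
      convert h1 using 1
      funext t
      by_cases ht : t = P.self x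
      · subst ht; simp
      · simp [ht]
    · refine Submodule.mem_comap.2 ?_
      convert h2 using 1
      funext t
      by_cases ht : t = P.self x
      · subst ht; simp
      · simp [ht]

/-- The direct sum is a biproduct in the category of representations. -/
def directSumBicone (V W : InvRep k P) : BinaryBicone V W where
  pt := directSum V W
  fst := ⟨LinearMap.fst k V.V₀ W.V₀, fun _ _ hh => hh.1⟩
  snd := ⟨LinearMap.snd k V.V₀ W.V₀, fun _ _ hh => hh.2⟩
  inl := ⟨LinearMap.inl k V.V₀ W.V₀, fun z _ hh => ⟨hh, (W.sub z).zero_mem⟩⟩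
  inr := ⟨LinearMap.inr k V.V₀ W.V₀, fun z _ hh => ⟨(V.sub z).zero_mem, hh⟩⟩
  inl_fst := rfl
  inl_snd := rfl
  inr_fst := rfl
  inr_snd := rfl

instance : HasBinaryBiproducts (InvRep k P) where
  has_binary_biproduct V W := HasBinaryBiproduct.mk
    { bicone := directSumBicone V W
      isBilimit := isBinaryBilimitOfTotal (directSumBicone V W)
        (Subtype.ext (LinearMap.ext fun p => by
          change (p.1 + 0, 0 + p.2) = p
          rw [add_zero, zero_add]
          rfl)) }

/-! ## The exact structure -/

/-- `ε`-sequences `X₁ → X₂ → X₃`: the sequence `0 → X₁ → X₂ → X₃ → 0` of the underlying vector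
spaces is exact, and so is the sequence of the `z`-components for every class `z`. -/
def IsEpsSequence (T : ShortComplex (InvRep k P)) : Prop :=
  (Function.Injective (lin T.f) ∧ Function.Exact (lin T.f) (lin T.g) ∧
    Function.Surjective (lin T.g)) ∧
  ∀ z : P.Θ, Function.Injective (onClass T.f z) ∧
    Function.Exact (onClass T.f z) (onClass T.g z) ∧ Function.Surjective (onClass T.g z)

/-- `ε`-deflations: the second morphisms of `ε`-sequences. -/
def IsDeflation {E W : InvRep k P} (v : E ⟶ W) : Prop :=
  ∃ (U : InvRep k P) (f : U ⟶ E) (hf : f ≫ v = 0), IsEpsSequence (ShortComplex.mk f v hf)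

/-- `ε`-inflations: the first morphisms of `ε`-sequences. -/
def IsInflation {U E : InvRep k P} (f : U ⟶ E) : Prop :=
  ∃ (W : InvRep k P) (v : E ⟶ W) (hf : f ≫ v = 0), IsEpsSequence (ShortComplex.mk f v hf)

/-- `ε`-projective representations. -/
def IsEpsProjective (Q : InvRep k P) : Prop :=
  ∀ ⦃E V : InvRep k P⦄ (g : E ⟶ V), IsDeflation g → ∀ f : Q ⟶ V, ∃ h : Q ⟶ E, h ≫ g = f

/-- `ε`-injective representations. -/
def IsEpsInjective (I : InvRep k P) : Prop :=
  ∀ ⦃V E : InvRep k P⦄ (f : V ⟶ E), IsInflation f → ∀ g : V ⟶ I, ∃ h : E ⟶ I, f ≫ h = g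

/-! ## Almost split sequences -/

/-- `f : X ⟶ Y` is left almost split: it is not a section, and every morphism `X ⟶ Z` which is
not a section factors through `f`. -/
def IsLeftAlmostSplit {X Y : InvRep k P} (f : X ⟶ Y) : Prop :=
  ¬ IsSplitMono f ∧
    ∀ ⦃Z : InvRep k P⦄ (h : X ⟶ Z), ¬ IsSplitMono h → ∃ h' : Y ⟶ Z, f ≫ h' = h

/-- `g : Y ⟶ X` is right almost split: it is not a retraction, and every morphism `Z ⟶ X` which
is not a retraction factors through `g`. -/
def IsRightAlmostSplit {Y X : InvRep k P} (g : Y ⟶ X) : Prop :=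
  ¬ IsSplitEpi g ∧
    ∀ ⦃Z : InvRep k P⦄ (h : Z ⟶ X), ¬ IsSplitEpi h → ∃ h' : Z ⟶ Y, h' ≫ g = h

/-- Almost split sequences of the exact category of representations. -/
def IsAlmostSplit (T : ShortComplex (InvRep k P)) : Prop :=
  IsEpsSequence T ∧ IsLeftAlmostSplit T.f ∧ IsRightAlmostSplit T.g

/-- `F` is a set of representatives of the isomorphism classes of representations with the
property `p`: every `F i` has it, the `F i` are pairwise non-isomorphic, and every representation
with the property is isomorphic to some `F i`. -/
def IsRepresentativeFamily {ι : Type*} (p : InvRep k P → Prop) (F : ι → InvRep k P) : Prop :=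
  (∀ i, p (F i)) ∧ (∀ i j, Nonempty (F i ≅ F j) → i = j) ∧
    ∀ V, p V → ∃ i, Nonempty (V ≅ F i)

end InvRep

/-! # The radical of a linear category -/

section Radical

variable (k : Type*) [Field k] {C : Type*} [Category C] [Preadditive C] [Linear k C]

/-- The radical `rad(X, Y)`: the morphisms `f : X ⟶ Y` such that `1 - gf` is invertible for every
`g : Y ⟶ X`. -/
def catRad (X Y : C) : Submodule k (X ⟶ Y) where
  carrier := {f | ∀ g : Y ⟶ X, IsIso (𝟙 X - f ≫ g)}
  zero_mem' := fun g => by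
    rw [Limits.zero_comp, sub_zero]; infer_instance
  add_mem' := by
    intro f₁ f₂ h₁ h₂ g
    have i₁ : IsIso (𝟙 X - f₁ ≫ g) := h₁ g
    have i₂ : IsIso (𝟙 X - f₂ ≫ (g ≫ inv (𝟙 X - f₁ ≫ g))) := h₂ _
    have e : 𝟙 X - (f₁ + f₂) ≫ g =
        (𝟙 X - f₂ ≫ (g ≫ inv (𝟙 X - f₁ ≫ g))) ≫ (𝟙 X - f₁ ≫ g) := by
      rw [Preadditive.sub_comp (𝟙 X), Category.assoc, Category.assoc, IsIso.inv_hom_id,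
        Category.comp_id, Category.id_comp, Preadditive.add_comp]
      abel
    rw [e]
    infer_instance
  smul_mem' := by
    intro c f h g
    have i : IsIso (𝟙 X - f ≫ (c • g)) := h _
    rw [Linear.comp_smul] at i
    rw [Linear.smul_comp]
    exact i

/-- The square of the radical: the span of the composites `X ⟶ Z ⟶ Y` of two radical morphisms. -/
def catRadSq (X Y : C) : Submodule k (X ⟶ Y) :=
  Submodule.span k {h | ∃ (Z : C) (f : X ⟶ Z) (g : Z ⟶ Y),
    f ∈ catRad k X Z ∧ g ∈ catRad k Z Y ∧ f ≫ g = h}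

/-- The dimension of the space `rad(X, Y) / rad²(X, Y)` of irreducible morphisms, i.e. (for
indecomposable `X`, `Y` over an algebraically closed field) the number of arrows `X → Y` of the
Auslander–Reiten quiver. -/
noncomputable def irrDim (X Y : C) : ℕ :=
  Module.finrank k (catRad k X Y ⧸ (catRadSq k X Y).submoduleOf (catRad k X Y))

end Radical

/-! # The poset with involution `𝔘_n` -/

/-- The points `a_i`, `b_i` (`1 ≤ i ≤ n`). -/
inductive UPoint (n : ℕ) : Type
  | a (i : Set.Icc 1 n)
  | b (i : Set.Icc 1 n)

namespace UPoint

variable {n : ℕ}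

/-- The index of a point: `i` for `a_i` and `b_i`. -/
def idx : UPoint n → Set.Icc 1 n
  | a i => i
  | b i => i

/-- The position of a point in the chain `a_n < ⋯ < a_1 < b_1 < ⋯ < b_n`. -/
def height : UPoint n → ℤ
  | a i => -(i.1 : ℤ)
  | b i => (i.1 : ℤ)

theorem height_injective : Function.Injective (height (n := n)) := by
  rintro (⟨i, hi⟩ | ⟨i, hi⟩) (⟨j, hj⟩ | ⟨j, hj⟩) h <;> simp only [height, Set.mem_Icc] at h hi hj
  · congr 2; omega
  · omega
  · omega
  · congr 2; omega

/-- The chain `a_n < ⋯ < a_1 < b_1 < ⋯ < b_n`. -/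
noncomputable instance : PartialOrder (UPoint n) := PartialOrder.lift height height_injective

theorem lt_iff (x y : UPoint n) : x < y ↔ x.height < y.height := Iff.rfl

/-- The function on points with value `p` at every `a_i` and `q` at every `b_i`. -/
def elim {M : Type*} (p q : M) : UPoint n → M
  | a _ => p
  | b _ => q

end UPoint

/-- The poset with involution `𝔘_n`: the chain `a_n < ⋯ < a_1 < b_1 < ⋯ < b_n` with the classes
`{a_i, b_i}`, `1 ≤ i ≤ n`. -/
noncomputable abbrev UPoset (n : ℕ) : InvPoset.{0} where
  Pt := UPoint n
  Θ := Set.Icc 1 n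
  cls := UPoint.idx
  cls_surj := fun i => ⟨UPoint.a i, rfl⟩
  card_le_two := fun z => by
    refine (Set.encard_le_encard (t := {UPoint.a z, UPoint.b z}) ?_).trans
      (Set.encard_pair (by simp)).le
    rintro (i | i) (rfl : i = z)
    · exact Or.inl rfl
    · exact Or.inr rfl

namespace UPoset

variable {n : ℕ}

/-- The element `(p, q)` of `V₀^z`, where `z = (a_j, b_j)`. -/
def pair {M : Type*} (j : Set.Icc 1 n) (p q : M) : (UPoset n).Cls j → M := fun x => x.1.elim p q

theorem exists_pair {M : Type*} (j : Set.Icc 1 n) (h : (UPoset n).Cls j → M) :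
    ∃ p q, h = pair j p q := by
  refine ⟨h ⟨UPoint.a j, rfl⟩, h ⟨UPoint.b j, rfl⟩, ?_⟩
  funext ⟨x, hx⟩
  rcases x with i | i <;> (obtain rfl : i = j := hx; rfl)

section

variable {k : Type u} [Field k] {M : Type u} [AddCommGroup M] [Module k M]

theorem pair_mem_span_one {j : Set.Icc 1 n} {p q p' q' : M} :
    pair j p q ∈ Submodule.span k {pair j p' q'} ↔ ∃ c : k, c • p' = p ∧ c • q' = q := by
  rw [Submodule.mem_span_singleton]
  constructor
  · rintro ⟨c, hc⟩
    exact ⟨c, congrFun hc ⟨UPoint.a j, rfl⟩, congrFun hc ⟨UPoint.b j, rfl⟩⟩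
  · rintro ⟨c, rfl, rfl⟩
    exact ⟨c, by funext ⟨x, hx⟩; rcases x with i | i <;> rfl⟩

theorem pair_mem_span_two {j : Set.Icc 1 n} {p q p' q' p'' q'' : M} :
    pair j p q ∈ Submodule.span k {pair j p' q', pair j p'' q''} ↔
      ∃ c d : k, c • p' + d • p'' = p ∧ c • q' + d • q'' = q := by
  rw [Submodule.mem_span_pair]
  constructor
  · rintro ⟨c, d, hc⟩
    exact ⟨c, d, congrFun hc ⟨UPoint.a j, rfl⟩, congrFun hc ⟨UPoint.b j, rfl⟩⟩
  · rintro ⟨c, d, rfl, rfl⟩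
    exact ⟨c, d, by funext ⟨x, hx⟩; rcases x with i | i <;> rfl⟩

theorem pair_mem_bot {j : Set.Icc 1 n} {p q : M} :
    pair j p q ∈ (⊥ : Submodule k ((UPoset n).Cls j → M)) ↔ p = 0 ∧ q = 0 := by
  rw [Submodule.mem_bot]
  constructor
  · intro h
    exact ⟨congrFun h ⟨UPoint.a j, rfl⟩, congrFun h ⟨UPoint.b j, rfl⟩⟩
  · rintro ⟨rfl, rfl⟩
    funext ⟨x, hx⟩; rcases x with i | i <;> rfl

/-- The condition `V_y⁺ ⊆ V_x⁻` for `y < x`, for the poset `𝔘_n`, in terms of pairs. -/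
theorem plus_le_minus_of (V : ∀ j : Set.Icc 1 n, Submodule k ((UPoset n).Cls j → M))
    (haa : ∀ i j : Set.Icc 1 n, j.1 < i.1 → ∀ p q, pair i p q ∈ V i → pair j p 0 ∈ V j)
    (hab : ∀ i j : Set.Icc 1 n, ∀ p q, pair i p q ∈ V i → pair j 0 p ∈ V j)
    (hbb : ∀ i j : Set.Icc 1 n, i.1 < j.1 → ∀ p q, pair i p q ∈ V i → pair j 0 q ∈ V j)
    (x y : (UPoset n).Pt) (hyx : y < x) :
    (UPoset n).plus y (V ((UPoset n).cls y)) ≤ (UPoset n).minus x (V ((UPoset n).cls x)) := by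
  classical
  rintro _ ⟨h, hh, rfl⟩
  have key : ∀ v : M, (x.elim (pair ((UPoset n).cls x) v 0) (pair ((UPoset n).cls x) 0 v)) ∈
      V ((UPoset n).cls x) → v ∈ (UPoset n).minus x (V ((UPoset n).cls x)) := by
    intro v hv
    refine Submodule.mem_comap.2 (Set.mem_of_eq_of_mem ?_ hv)
    funext ⟨t, ht⟩
    rcases x with i | i <;> rcases t with j | j <;> obtain rfl : j = i := ht
    · exact Pi.single_eq_same _ _
    · exact Pi.single_eq_of_ne (fun h => by cases congrArg Subtype.val h) _
    · exact Pi.single_eq_of_ne (fun h => by cases congrArg Subtype.val h) _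
    · exact Pi.single_eq_same _ _
  refine key _ ?_
  obtain ⟨p, q, rfl⟩ := exists_pair _ h
  rcases y with i | i <;> rcases x with j | j <;>
    have hlt := (UPoint.lt_iff _ _).1 hyx <;> simp only [UPoint.height] at hlt
  · exact haa i j (by omega) p q hh
  · exact hab i j p q hh
  · have := i.2.1; have := j.2.1; omega
  · exact hbb i j (by omega) p q hh

/-- A linear map which respects pairs is a morphism of representations of `𝔘_n`. -/
def homMk {V W : InvRep k (UPoset n)} (φ : V.V₀ →ₗ[k] W.V₀)
    (h : ∀ (j : Set.Icc 1 n) (p q : V.V₀), pair j p q ∈ V.sub j →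
      pair j (φ p) (φ q) ∈ W.sub j) : V ⟶ W :=
  ⟨φ, fun z f hf => by
    obtain ⟨p, q, rfl⟩ := exists_pair z f
    refine Set.mem_of_eq_of_mem ?_ (h z p q hf)
    funext ⟨x, hx⟩; rcases x with i | i <;> rfl⟩

end

/-! ## The representations `S`, `𝓛_{1,i}`, `𝓛_{2,i}`, `𝓛_{3,i}` -/

/-- The trivial representation `S = (k, 0)`. -/
noncomputable def S (k : Type u) [Field k] (n : ℕ) : InvRep k (UPoset n) where
  V₀ := k
  sub _ := ⊥
  plus_le_minus := by
    refine plus_le_minus_of (fun _ => ⊥) ?_ ?_ ?_ <;> intros <;>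
      simp_all only [pair_mem_bot, and_self]

/-- The subspaces of `𝓛_{1,i}`, where `e = 1`. -/
noncomputable def sub₁ (k : Type u) [Field k] {n : ℕ} (i : ℕ) (j : Set.Icc 1 n) :
    Submodule k ((UPoset n).Cls j → k) :=
  if j.1 < i then ⊥ else Submodule.span k {pair j 0 1}

/-- The subspaces of `𝓛_{2,i}`, where `e = 1`. -/
noncomputable def sub₂ (k : Type u) [Field k] {n : ℕ} (i : ℕ) (j : Set.Icc 1 n) :
    Submodule k ((UPoset n).Cls j → k) :=
  if j.1 ≤ i then Submodule.span k {pair j 0 1, pair j 1 0}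
  else Submodule.span k {pair j 0 1}

/-- The subspaces of `𝓛_{3,i}`, where `e₁ = (1, 0)` and `e₂ = (0, 1)`. -/
noncomputable def sub₃ (k : Type u) [Field k] {n : ℕ} (i : ℕ) (j : Set.Icc 1 n) :
    Submodule k ((UPoset n).Cls j → k × k) :=
  if j.1 < i then Submodule.span k {pair j 0 (1, 0), pair j (1, 0) 0}
  else if j.1 = i then Submodule.span k {pair j 0 (1, 0), pair j (1, 0) (0, 1)}
  else Submodule.span k {pair j 0 (1, 0), pair j 0 (0, 1)}

section

variable {k : Type u} [Field k] {i : ℕ} {j : Set.Icc 1 n}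

theorem mem_sub₁ {p q : k} : pair j p q ∈ sub₁ k i j ↔ p = 0 ∧ (j.1 < i → q = 0) := by
  unfold sub₁
  split_ifs with h
  · rw [pair_mem_bot]; simp [h]
  · simp [pair_mem_span_one, h, eq_comm]

theorem mem_sub₂ {p q : k} : pair j p q ∈ sub₂ k i j ↔ (i < j.1 → p = 0) := by
  unfold sub₂
  split_ifs with h
  · simp [pair_mem_span_two, h]
  · simp [pair_mem_span_one, not_le.1 h, eq_comm]

theorem mem_sub₃ {p q : k × k} : pair j p q ∈ sub₃ k i j ↔
    p.2 = 0 ∧ (j.1 < i → q.2 = 0) ∧ (j.1 = i → p.1 = q.2) ∧ (i < j.1 → p.1 = 0) := by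
  obtain ⟨p, p'⟩ := p
  obtain ⟨q, q'⟩ := q
  unfold sub₃
  split_ifs with h h'
  · have h1 : ¬ j.1 = i := by omega
    have h2 : ¬ i < j.1 := by omega
    simp [pair_mem_span_two, h, h1, h2, eq_comm]
  · simp [pair_mem_span_two, h', eq_comm]
    tauto
  · have h1 : i < j.1 := by omega
    simp [pair_mem_span_two, h, h1, h', Prod.ext_iff, @eq_comm _ (0 : k), and_comm]

end

/-- `𝓛_{1,i}`, on the space `k e`. -/
noncomputable def L₁ (k : Type u) [Field k] (n i : ℕ) : InvRep k (UPoset n) where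
  V₀ := k
  sub := sub₁ k i
  plus_le_minus := by
    refine plus_le_minus_of (sub₁ k i) ?_ ?_ ?_ <;> intros <;> simp_all only [mem_sub₁] <;> grind

/-- `𝓛_{2,i}`, on the space `k e`. -/
noncomputable def L₂ (k : Type u) [Field k] (n i : ℕ) : InvRep k (UPoset n) where
  V₀ := k
  sub := sub₂ k i
  plus_le_minus := by
    refine plus_le_minus_of (sub₂ k i) ?_ ?_ ?_ <;> intros <;> simp_all only [mem_sub₂] <;> grind

/-- `𝓛_{3,i}`, on the space `k e₁ ⊕ k e₂`. -/
noncomputable def L₃ (k : Type u) [Field k] (n i : ℕ) : InvRep k (UPoset n) where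
  V₀ := k × k
  sub := sub₃ k i
  plus_le_minus := by
    refine plus_le_minus_of (sub₃ k i) ?_ ?_ ?_ <;> intros <;> simp_all only [mem_sub₃] <;>
      simp <;> grind

/-! ## Morphisms between them -/

section

variable (k : Type u) [Field k] (n : ℕ)

/-- `𝓛_{1,i} → 𝓛_{3,j}`, `e ↦ e₁`. -/
noncomputable def L₁inl (i j : ℕ) : L₁ k n i ⟶ L₃ k n j :=
  homMk (LinearMap.inl k k k : k →ₗ[k] k × k) fun l (p q : k) h => by
    have h := mem_sub₁.1 h
    refine (mem_sub₃ (p := ((p, 0) : k × k)) (q := ((q, 0) : k × k))).2 ?_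
    grind

/-- `𝓛_{2,i} → 𝓛_{3,j}`, `e ↦ e₁`, for `i < j`. -/
noncomputable def L₂inl {i j : ℕ} (hij : i < j) : L₂ k n i ⟶ L₃ k n j :=
  homMk (LinearMap.inl k k k : k →ₗ[k] k × k) fun l (p q : k) h => by
    have h := mem_sub₂.1 h
    refine (mem_sub₃ (p := ((p, 0) : k × k)) (q := ((q, 0) : k × k))).2 ?_
    grind

/-- `𝓛_{1,i} → 𝓛_{3,j}`, `e ↦ e₂`, for `j < i`. -/
noncomputable def L₁inr {i j : ℕ} (hij : j < i) : L₁ k n i ⟶ L₃ k n j :=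
  homMk (LinearMap.inr k k k : k →ₗ[k] k × k) fun l (p q : k) h => by
    have h := mem_sub₁.1 h
    refine (mem_sub₃ (p := ((0, p) : k × k)) (q := ((0, q) : k × k))).2 ?_
    grind

/-- `S → 𝓛_{3,j}`, `1 ↦ e₂`. -/
noncomputable def Sinr (j : ℕ) : S k n ⟶ L₃ k n j :=
  homMk (LinearMap.inr k k k : k →ₗ[k] k × k) fun l (p q : k) h => by
    have h := pair_mem_bot.1 h
    refine (mem_sub₃ (p := ((0, p) : k × k)) (q := ((0, q) : k × k))).2 ?_
    grind

/-- `𝓛_{3,i} → 𝓛_{1,j}`, `e₁ ↦ 0`, `e₂ ↦ e`, for `j ≤ i`. -/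
noncomputable def L₁snd {i j : ℕ} (hij : j ≤ i) : L₃ k n i ⟶ L₁ k n j :=
  homMk (LinearMap.snd k k k : k × k →ₗ[k] k) fun l (p q : k × k) h => by
    have h := mem_sub₃.1 h
    refine (mem_sub₁ (p := p.2) (q := q.2)).2 ?_
    grind

/-- `𝓛_{3,i} → 𝓛_{2,j}`, `e₁ ↦ e`, `e₂ ↦ 0`, for `i ≤ j`. -/
noncomputable def L₂fst {i j : ℕ} (hij : i ≤ j) : L₃ k n i ⟶ L₂ k n j :=
  homMk (LinearMap.fst k k k : k × k →ₗ[k] k) fun l (p q : k × k) h => by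
    have h := mem_sub₃.1 h
    refine (mem_sub₂ (p := p.1) (q := q.1)).2 ?_
    grind

/-! ## The four kinds of sequences -/

/-- `𝓛_{1,1} → 𝓛_{3,1} → 𝓛_{1,1}`, with maps `(1,0)ᵗ` and `(0,1)`. -/
noncomputable def seq₁₁ : ShortComplex (InvRep k (UPoset n)) where
  X₁ := L₁ k n 1
  X₂ := L₃ k n 1
  X₃ := L₁ k n 1
  f := L₁inl k n 1 1
  g := L₁snd k n le_rfl
  zero := Subtype.ext (LinearMap.snd_comp_inl k k k)

/-- `𝓛_{1,i+1} → 𝓛_{3,i} → 𝓛_{2,i}`, with maps `(0,1)ᵗ` and `(1,0)`. -/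
noncomputable def seq₁₂ (i : ℕ) : ShortComplex (InvRep k (UPoset n)) where
  X₁ := L₁ k n (i + 1)
  X₂ := L₃ k n i
  X₃ := L₂ k n i
  f := L₁inr k n i.lt_succ_self
  g := L₂fst k n le_rfl
  zero := Subtype.ext (LinearMap.fst_comp_inr k k k)

/-- `𝓛_{2,i} → 𝓛_{3,i+1} → 𝓛_{1,i+1}`, with maps `(1,0)ᵗ` and `(0,1)`. -/
noncomputable def seq₂₁ (i : ℕ) : ShortComplex (InvRep k (UPoset n)) where
  X₁ := L₂ k n i
  X₂ := L₃ k n (i + 1)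
  X₃ := L₁ k n (i + 1)
  f := L₂inl k n i.lt_succ_self
  g := L₁snd k n le_rfl
  zero := Subtype.ext (LinearMap.snd_comp_inl k k k)

/-- `S → 𝓛_{3,n} → 𝓛_{2,n}`, with maps `(0,1)ᵗ` and `(1,0)`. -/
noncomputable def seqS : ShortComplex (InvRep k (UPoset n)) where
  X₁ := S k n
  X₂ := L₃ k n n
  X₃ := L₂ k n n
  f := Sinr k n n
  g := L₂fst k n le_rfl
  zero := Subtype.ext (LinearMap.fst_comp_inr k k k)

end

/-! ## The quiver -/

/-- The vertices `S`, `𝓛_{1,i}`, `𝓛_{2,i}`, `𝓛_{3,i}` (`1 ≤ i ≤ n`) of the Auslander–Reiten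
quiver. -/
inductive Vertex (n : ℕ) : Type
  | S
  | L₁ (i : Set.Icc 1 n)
  | L₂ (i : Set.Icc 1 n)
  | L₃ (i : Set.Icc 1 n)

/-- The representation belonging to a vertex. -/
noncomputable def Vertex.toRep (k : Type u) [Field k] {n : ℕ} :
    Vertex n → InvRep k (UPoset n)
  | .S => UPoset.S k n
  | .L₁ i => UPoset.L₁ k n i
  | .L₂ i => UPoset.L₂ k n i
  | .L₃ i => UPoset.L₃ k n i

/-- The arrows of the quiver: `𝓛_{1,1} → 𝓛_{3,1}` and `𝓛_{1,i+1} → 𝓛_{3,i}`,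
`𝓛_{2,i} → 𝓛_{3,i+1}`, `S → 𝓛_{3,n}`, `𝓛_{3,i} → 𝓛_{1,i}`, `𝓛_{3,i} → 𝓛_{2,i}`. -/
def Vertex.Arrow {n : ℕ} : Vertex n → Vertex n → Prop
  | .L₁ i, .L₃ j => (i.1 = 1 ∧ j.1 = 1) ∨ i.1 = j.1 + 1
  | .L₂ i, .L₃ j => j.1 = i.1 + 1
  | .S, .L₃ j => j.1 = n
  | .L₃ i, .L₁ j => i = j
  | .L₃ i, .L₂ j => i = j
  | _, _ => False

/-- `v.IsTranslateOf w`: the vertex `v` is the Auslander–Reiten translate `τ w`, namely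
`τ 𝓛_{1,1} = 𝓛_{1,1}`, `τ 𝓛_{1,i+1} = 𝓛_{2,i}`, `τ 𝓛_{2,i} = 𝓛_{1,i+1}` and `τ 𝓛_{2,n} = S`. -/
def Vertex.IsTranslateOf {n : ℕ} : Vertex n → Vertex n → Prop
  | .L₁ i, .L₁ j => i.1 = 1 ∧ j.1 = 1
  | .L₂ i, .L₁ j => j.1 = i.1 + 1
  | .L₁ i, .L₂ j => i.1 = j.1 + 1
  | .S, .L₂ j => j.1 = n
  | _, _ => False

end UPoset

/-! For y < x one has V_y⁻ ⊆ V_y⁺ ⊆ V_x⁻ ⊆ V_x⁺, so a representation carries a filtration of V₀ by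
the subspaces V_{a_n}⁻ ⊆ V_{a_n}⁺ ⊆ … ⊆ V_{a_1}⁺ ⊆ V_{b_1}⁻ ⊆ … ⊆ V_{b_n}⁺ ⊆ V₀, and V_{z_i}
identifies V_{a_i}⁺/V_{a_i}⁻ with V_{b_i}⁺/V_{b_i}⁻. The listed representations represent the steps:
morphisms to V from S, 𝓛_{1,i}, 𝓛_{2,i}, 𝓛_{3,i} are the elements of V₀, V_{b_i}⁻, V_{a_i}⁻,
V_{z_i}. Dually, morphisms V → 𝓛_{3,i} are pairs of functionals (φ, ψ) with φ(p) = ψ(q) on V_{z_i}.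

The key point is a splitting criterion: if the element defining a morphism lies outside the
preceding term of the filtration (for 𝓛_{3,i}: if its first entry lies outside V_{a_i}⁻), a
functional separating the two yields a retraction (`isSplitMono_ofS` to `isSplitMono_ofL₃`). Two
consequences follow. If no listed representation is a direct summand of V, all steps of the
filtration vanish and V = 0, which classifies the indecomposables (`exists_iso_toRep`). And a
morphism that does not split is given by an element of the preceding term, that is, by an entry of
some pair in a V_{z_j}, so it factors through 𝓛_{3,j}: this is the left almost split property. The
right almost split property is an extension argument for functionals (`exists_comp_L₂fst`,
`exists_comp_L₁snd`).

Projectivity of 𝓛_{3,i} is surjectivity of deflations on V_{z_i}, its injectivity is extension of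
functionals, and the almost split sequences exclude the other candidates. An almost split sequence
is determined by its end term (`IsAlmostSplit.nonempty_iso`), so the list is complete. The arrows
are read off from the left almost split morphisms starting at each vertex; 𝓛_{2,n} has zero radical
morphisms only, and 𝓛_{3,i} maps to 𝓛_{2,i} ⊕ 𝓛_{1,i}. -/

/-! # Objects with local endomorphism ring -/

section LocalEnd

variable {C : Type*} [Category C] [Preadditive C]

/-- `X` is nonzero and every endomorphism `f` of `X` is invertible or has `1 - f` invertible. -/
def HasLocalEnd (X : C) : Prop :=
  ¬ IsZero X ∧ ∀ f : X ⟶ X, IsIso f ∨ IsIso (𝟙 X - f)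

theorem eq_zero_of_comp_isIso_sub {X Y : C} {f : X ⟶ Y} {e : Y ⟶ Y} (he : IsIso (𝟙 Y - e))
    (h : f ≫ e = f) : f = 0 := by
  have : f ≫ (𝟙 Y - e) = 0 := by rw [Preadditive.comp_sub, Category.comp_id, h, sub_self]
  exact (cancel_mono (𝟙 Y - e)).1 (by rw [this, zero_comp])

/-- The idempotent `retraction f ≫ f` of Y is invertible, making f a split epimorphism as well, or
has invertible complement, which forces f = 0 and hence X = 0. -/
theorem isIso_of_isSplitMono_of_hasLocalEnd {X Y : C} (hY : HasLocalEnd Y) (hX : ¬ IsZero X)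
    (f : X ⟶ Y) [IsSplitMono f] : IsIso f := by
  have hf : f ≫ retraction f ≫ f = f := by rw [IsSplitMono.id_assoc]
  rcases hY.2 (retraction f ≫ f) with he | he
  · have : IsSplitEpi f := IsSplitEpi.mk' ⟨inv (retraction f ≫ f) ≫ retraction f, by
      rw [Category.assoc, IsIso.inv_hom_id]⟩
    exact isIso_of_mono_of_isSplitEpi f
  · exact absurd ((IsZero.iff_isSplitMono_eq_zero f).2 (eq_zero_of_comp_isIso_sub he hf)) hX

theorem isIso_of_isSplitEpi_of_hasLocalEnd {X Y : C} (hX : HasLocalEnd X) (hY : ¬ IsZero Y)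
    (f : X ⟶ Y) [IsSplitEpi f] : IsIso f := by
  have := isIso_of_isSplitMono_of_hasLocalEnd hX hY (section_ f)
  have h : f = inv (section_ f) := by
    rw [← cancel_epi (section_ f), IsSplitEpi.id, IsIso.hom_inv_id]
  rw [h]; infer_instance

theorem HasLocalEnd.of_iso {X Y : C} (hX : HasLocalEnd X) (i : X ≅ Y) : HasLocalEnd Y := by
  refine ⟨fun h => hX.1 (h.of_iso i), fun f => ?_⟩
  have key : ∀ g : Y ⟶ Y, IsIso (i.hom ≫ g ≫ i.inv) → IsIso g := by
    intro g hg
    have : g = i.inv ≫ (i.hom ≫ g ≫ i.inv) ≫ i.hom := by simp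
    rw [this]; infer_instance
  refine (hX.2 (i.hom ≫ f ≫ i.inv)).imp (key f) fun h => key _ ?_
  simpa using h

/-- The projection of X onto the summand Y annihilates Z, and its complement annihilates Y; one of
the two is invertible. -/
theorem HasLocalEnd.indecomposable [HasBinaryBiproducts C] {X : C} (hX : HasLocalEnd X) :
    Indecomposable X := by
  refine ⟨hX.1, fun Y Z i => ?_⟩
  rcases hX.2 (i.hom ≫ biprod.fst ≫ biprod.inl ≫ i.inv) with he | he
  · right
    have h0 : (biprod.inr ≫ i.inv) ≫ i.hom ≫ biprod.fst ≫ biprod.inl ≫ i.inv = 0 := by simp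
    have h1 : biprod.inr ≫ i.inv = 0 := (cancel_mono _).1 (h0.trans zero_comp.symm)
    rw [IsZero.iff_id_eq_zero, ← biprod.inr_snd (X := Y)]
    have h2 : (biprod.inr : Z ⟶ Y ⊞ Z) = 0 := (cancel_mono i.inv).1 (by rw [h1, zero_comp])
    rw [h2, zero_comp]
  · left
    have h1 : biprod.inl ≫ i.inv = 0 := eq_zero_of_comp_isIso_sub he (by simp)
    rw [IsZero.iff_id_eq_zero, ← biprod.inl_fst (Y := Z)]
    have h2 : (biprod.inl : Y ⟶ Y ⊞ Z) = 0 := (cancel_mono i.inv).1 (by rw [h1, zero_comp])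
    rw [h2, zero_comp]

/-- The complement of a retract: `X ≅ Y ⊞ Z` from the data of a direct sum decomposition. -/
theorem nonempty_iso_biprod [HasBinaryBiproducts C] {X Y Z : C} (f : Y ⟶ X) (g : X ⟶ Y)
    (i : Z ⟶ X) (p : X ⟶ Z) (hfg : f ≫ g = 𝟙 Y) (hip : i ≫ p = 𝟙 Z) (hfp : f ≫ p = 0)
    (hig : i ≫ g = 0) (total : g ≫ f + p ≫ i = 𝟙 X) : Nonempty (X ≅ Y ⊞ Z) :=
  ⟨{ hom := biprod.lift g p
     inv := biprod.desc f i
     hom_inv_id := by rw [biprod.lift_desc, total]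
     inv_hom_id := by ext <;> simp [hfg, hip, hfp, hig] }⟩

end LocalEnd

/-! # The radical and irreducible morphisms -/

section Radical

variable {k : Type*} [Field k] {C : Type*} [Category C] [Preadditive C] [Linear k C]

/-- The inverse of 1 - f ≫ g is 1 + f ≫ (1 - g ≫ f)⁻¹ ≫ g. This makes the one-sided definition of
the radical symmetric, so that `catRad` is stable under precomposition. -/
theorem isIso_one_sub_swap {X Y : C} (f : X ⟶ Y) (g : Y ⟶ X) (h : IsIso (𝟙 Y - g ≫ f)) :
    IsIso (𝟙 X - f ≫ g) := by
  have h1 : inv (𝟙 Y - g ≫ f) ≫ g ≫ f = inv (𝟙 Y - g ≫ f) - 𝟙 Y := by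
    have := IsIso.inv_hom_id (𝟙 Y - g ≫ f)
    rw [Preadditive.comp_sub, Category.comp_id] at this
    exact eq_sub_of_add_eq' (sub_eq_iff_eq_add.1 this).symm
  have h2 : g ≫ f ≫ inv (𝟙 Y - g ≫ f) = inv (𝟙 Y - g ≫ f) - 𝟙 Y := by
    have := IsIso.hom_inv_id (𝟙 Y - g ≫ f)
    rw [Preadditive.sub_comp, Category.id_comp, Category.assoc] at this
    exact eq_sub_of_add_eq' (sub_eq_iff_eq_add.1 this).symm
  refine ⟨𝟙 X + f ≫ inv (𝟙 Y - g ≫ f) ≫ g, ?_, ?_⟩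
  · simp only [Preadditive.sub_comp, Preadditive.comp_add, Category.assoc, Category.id_comp,
      Category.comp_id]
    have : f ≫ g ≫ f ≫ inv (𝟙 Y - g ≫ f) ≫ g = f ≫ (g ≫ f ≫ inv (𝟙 Y - g ≫ f)) ≫ g := by simp
    rw [this, h2]
    simp
  · simp only [Preadditive.comp_sub, Preadditive.add_comp, Category.assoc, Category.id_comp,
      Category.comp_id]
    have : f ≫ inv (𝟙 Y - g ≫ f) ≫ g ≫ f ≫ g = f ≫ (inv (𝟙 Y - g ≫ f) ≫ g ≫ f) ≫ g := by simp
    rw [this, h1]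
    simp

theorem comp_mem_catRad_right {X Y Z : C} (f : X ⟶ Y) {g : Y ⟶ Z} (hg : g ∈ catRad k Y Z) :
    f ≫ g ∈ catRad k X Z := fun h => by
  rw [Category.assoc]
  refine isIso_one_sub_swap _ _ ?_
  rw [Category.assoc]
  exact hg _

theorem mem_catRad_of_not_isSplitMono {X Y : C} (hX : HasLocalEnd X) {f : X ⟶ Y}
    (hf : ¬ IsSplitMono f) : f ∈ catRad k X Y := fun g =>
  (hX.2 (f ≫ g)).resolve_left fun h => hf (IsSplitMono.mk' ⟨g ≫ inv (f ≫ g), by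
    rw [← Category.assoc, IsIso.hom_inv_id]⟩)

theorem not_isSplitMono_of_mem_catRad {X Y : C} (hX : ¬ IsZero X) {f : X ⟶ Y}
    (hf : f ∈ catRad k X Y) : ¬ IsSplitMono f := fun h => by
  have := hf (retraction f)
  rw [IsSplitMono.id, sub_self] at this
  exact hX ((IsZero.iff_id_eq_zero X).2 ((cancel_mono (0 : X ⟶ X)).1 (by simp)))

theorem comp_mem_catRadSq {X Y Z : C} {f : X ⟶ Y} {g : Y ⟶ Z} (hf : f ∈ catRad k X Y)
    (hg : g ∈ catRad k Y Z) : f ≫ g ∈ catRadSq k X Z :=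
  Submodule.subset_span ⟨Y, f, g, hf, hg, rfl⟩

theorem irrDim_eq_zero_of_le {X Y : C} (h : catRad k X Y ≤ catRadSq k X Y) : irrDim k X Y = 0 := by
  have : (catRadSq k X Y).submoduleOf (catRad k X Y) = ⊤ := Submodule.submoduleOf_eq_top.2 h
  have : Subsingleton (catRad k X Y ⧸ (catRadSq k X Y).submoduleOf (catRad k X Y)) :=
    Submodule.Quotient.subsingleton_iff.2 this
  exact Module.finrank_zero_of_subsingleton

theorem irrDim_eq_one_of_exists {X Y : C} (f : X ⟶ Y) (hf : f ∈ catRad k X Y)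
    (hf' : f ∉ catRadSq k X Y)
    (h : ∀ g ∈ catRad k X Y, ∃ c : k, c • f - g ∈ catRadSq k X Y) : irrDim k X Y = 1 := by
  refine finrank_eq_one (Submodule.Quotient.mk ⟨f, hf⟩) ?_ fun q => ?_
  · rw [Ne, Submodule.Quotient.mk_eq_zero]
    exact hf'
  · obtain ⟨⟨g, hg⟩, rfl⟩ := Submodule.Quotient.mk_surjective _ q
    obtain ⟨c, hc⟩ := h g hg
    refine ⟨c, ?_⟩
    rw [← Submodule.Quotient.mk_smul, Submodule.Quotient.eq]
    exact hc

/-! ### Irreducible morphisms and left almost split morphisms -/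

section

variable {X E₁ E₂ : C} {f₁ : X ⟶ E₁} {f₂ : X ⟶ E₂}

theorem irrDim_eq_zero_of_leftAlmostSplit (hX : ¬ IsZero X)
    (hfac : ∀ ⦃Z : C⦄ (h : X ⟶ Z), ¬ IsSplitMono h →
      ∃ (h₁ : E₁ ⟶ Z) (h₂ : E₂ ⟶ Z), f₁ ≫ h₁ + f₂ ≫ h₂ = h)
    {Y : C} (h₁ : ∀ t : E₁ ⟶ Y, f₁ ≫ t ∈ catRadSq k X Y)
    (h₂ : ∀ t : E₂ ⟶ Y, f₂ ≫ t ∈ catRadSq k X Y) : irrDim k X Y = 0 :=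
  irrDim_eq_zero_of_le fun f hf => by
    obtain ⟨t₁, t₂, rfl⟩ := hfac f (not_isSplitMono_of_mem_catRad hX hf)
    exact add_mem (h₁ t₁) (h₂ t₂)

/-- For a left almost split (f₁, f₂) : X → E₁ ⊕ E₂, the class of f₁ spans rad/rad²: modulo rad², the
f₂ part disappears and an endomorphism of E₁ acts as a scalar. Allowing E₂ serves 𝓛_{3,i}, where two
arrows start. -/
theorem irrDim_eq_one_of_leftAlmostSplit (hX : ¬ IsZero X)
    (hfac : ∀ ⦃Z : C⦄ (h : X ⟶ Z), ¬ IsSplitMono h →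
      ∃ (h₁ : E₁ ⟶ Z) (h₂ : E₂ ⟶ Z), f₁ ≫ h₁ + f₂ ≫ h₂ = h)
    (hf₁ : f₁ ∈ catRad k X E₁) (hne : ∀ t : E₂ ⟶ E₁, f₁ ≠ f₂ ≫ t)
    (h₂ : ∀ t : E₂ ⟶ E₁, f₂ ≫ t ∈ catRadSq k X E₁)
    (hE : ∀ e : E₁ ⟶ E₁, ∃ c : k, c • 𝟙 E₁ - e ∈ catRad k E₁ E₁) : irrDim k X E₁ = 1 := by
  refine irrDim_eq_one_of_exists f₁ hf₁ (fun hmem => ?_) fun g hg => ?_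
  -- If f₁ were in rad², factoring the first radical factor through (f₁, f₂) would give f₁ = f₁ ≫ r
  -- + f₂ ≫ t with r radical. Then 1 - r is invertible and f₁ would factor through f₂.
  · have hle : catRadSq k X E₁ ≤ (catRad k E₁ E₁).map (Linear.leftComp k E₁ f₁) ⊔
        LinearMap.range (Linear.leftComp k E₁ f₂) := by
      refine Submodule.span_le.2 ?_
      rintro _ ⟨Z, a, b, ha, hb, rfl⟩
      obtain ⟨t₁, t₂, rfl⟩ := hfac a (not_isSplitMono_of_mem_catRad hX ha)
      rw [Preadditive.add_comp, Category.assoc, Category.assoc]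
      exact Submodule.add_mem_sup ⟨t₁ ≫ b, comp_mem_catRad_right t₁ hb, rfl⟩ ⟨t₂ ≫ b, rfl⟩
    obtain ⟨_, ⟨r, hr, rfl⟩, _, ⟨t, rfl⟩, h⟩ := Submodule.mem_sup.1 (hle hmem)
    change f₁ ≫ r + f₂ ≫ t = f₁ at h
    have hi : IsIso (𝟙 E₁ - r) := by simpa using hr (𝟙 E₁)
    refine hne (t ≫ inv (𝟙 E₁ - r)) ?_
    rw [← Category.assoc, IsIso.eq_comp_inv, Preadditive.comp_sub, Category.comp_id, sub_eq_iff_eq_add,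
      add_comm, h]
  · obtain ⟨t₁, t₂, rfl⟩ := hfac g (not_isSplitMono_of_mem_catRad hX hg)
    obtain ⟨c, hc⟩ := hE t₁
    refine ⟨c, ?_⟩
    have : c • f₁ - (f₁ ≫ t₁ + f₂ ≫ t₂) = f₁ ≫ (c • 𝟙 E₁ - t₁) - f₂ ≫ t₂ := by
      rw [Preadditive.comp_sub, Linear.comp_smul, Category.comp_id]; abel
    rw [this]
    exact sub_mem (comp_mem_catRadSq hf₁ hc) (h₂ t₂)

end

/-- An object all of whose endomorphisms are a scalar plus a square-zero endomorphism. -/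
theorem hasLocalEnd_of_sq_zero {X : C} (hX : ¬ IsZero X)
    (h : ∀ e : X ⟶ X, ∃ c : k, (c • 𝟙 X - e) ≫ (c • 𝟙 X - e) = 0) : HasLocalEnd X := by
  refine ⟨hX, fun e => ?_⟩
  obtain ⟨c, hc⟩ := h e
  obtain ⟨m, rfl⟩ : ∃ m, e = c • 𝟙 X - m := ⟨c • 𝟙 X - e, by abel⟩
  rw [sub_sub_cancel] at hc
  by_cases h0 : c = 0
  · right
    subst h0
    refine ⟨𝟙 X - m, ?_, ?_⟩ <;> simp [hc]
  · left
    -- The geometric series for (c - m)⁻¹ stops after two terms because m² = 0.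
    refine ⟨c⁻¹ • 𝟙 X + (c⁻¹ * c⁻¹) • m, ?_, ?_⟩ <;>
    · simp only [Preadditive.add_comp, Preadditive.comp_add, Preadditive.sub_comp,
        Preadditive.comp_sub, Linear.smul_comp, Linear.comp_smul, Category.id_comp,
        Category.comp_id, hc, smul_zero, sub_zero, smul_sub, smul_add, smul_smul, mul_inv_cancel₀ h0,
        one_smul, mul_inv_cancel_left₀ h0, inv_mul_cancel₀ h0, mul_assoc, mul_one]
      abel

theorem mem_catRad_of_sq_zero {X : C} (hX : HasLocalEnd X) {m : X ⟶ X} (hm : m ≫ m = 0) :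
    m ∈ catRad k X X :=
  mem_catRad_of_not_isSplitMono hX fun h => by
    have h0 : m = 0 := (cancel_mono m).1 (hm.trans zero_comp.symm)
    exact hX.1 ((IsZero.iff_isSplitMono_eq_zero m).2 h0)

end Radical

/-! # Generalities on representations -/

namespace InvRep

variable {k : Type u} [Field k] {P : InvPoset.{w}}

theorem hom_ext {V W : InvRep k P} {f g : V ⟶ W} (h : lin f = lin g) : f = g := Subtype.ext h

theorem lin_comp_apply {U V W : InvRep k P} (f : U ⟶ V) (g : V ⟶ W) (x : U.V₀) :
    lin (f ≫ g) x = lin g (lin f x) := rfl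

theorem lin_id_apply {V : InvRep k P} (x : V.V₀) : lin (𝟙 V) x = x := rfl

theorem lin_zero_apply {V W : InvRep k P} (x : V.V₀) : lin (0 : V ⟶ W) x = 0 := rfl

theorem lin_add_apply {V W : InvRep k P} (f g : V ⟶ W) (x : V.V₀) :
    lin (f + g) x = lin f x + lin g x := rfl

theorem lin_sub_apply {V W : InvRep k P} (f g : V ⟶ W) (x : V.V₀) :
    lin (f - g) x = lin f x - lin g x := by
  rw [eq_sub_iff_add_eq, ← lin_add_apply, sub_add_cancel]

theorem isZero_iff {V : InvRep k P} : IsZero V ↔ ∀ x : V.V₀, x = 0 := by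
  rw [IsZero.iff_id_eq_zero]
  exact ⟨fun h x => by rw [← lin_id_apply x, h, lin_zero_apply],
    fun h => hom_ext (LinearMap.ext fun x => h x)⟩

theorem mono_of_injective {V W : InvRep k P} {f : V ⟶ W} (h : Function.Injective (lin f)) :
    Mono f :=
  ⟨fun a b hab => hom_ext (LinearMap.ext fun x => h (by
    rw [← lin_comp_apply, ← lin_comp_apply, hab]))⟩

theorem epi_of_surjective {V W : InvRep k P} {f : V ⟶ W} (h : Function.Surjective (lin f)) :
    Epi f :=
  ⟨fun a b hab => hom_ext (LinearMap.ext fun x => by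
    obtain ⟨y, rfl⟩ := h x
    rw [← lin_comp_apply, ← lin_comp_apply, hab])⟩

/-- Finite dimension of V₀ enters here: one-sided inverses of endomorphisms are two-sided. -/
theorem comp_eq_id_swap {V : InvRep k P} {f g : V ⟶ V} (h : f ≫ g = 𝟙 V) : g ≫ f = 𝟙 V := by
  have h' : lin g * lin f = 1 := congrArg lin h
  exact hom_ext (mul_eq_one_comm.1 h')

theorem isIso_of_isSplitMono_endo {V : InvRep k P} (f : V ⟶ V) [IsSplitMono f] : IsIso f :=
  ⟨retraction f, IsSplitMono.id f, comp_eq_id_swap (IsSplitMono.id f)⟩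

theorem isIso_of_isSplitEpi_endo {V : InvRep k P} (f : V ⟶ V) [IsSplitEpi f] : IsIso f :=
  ⟨section_ f, comp_eq_id_swap (IsSplitEpi.id f), IsSplitEpi.id f⟩

/-! ## Direct complements -/

/-- The restriction of a representation to a subspace of `V₀`. -/
def restrict (V : InvRep k P) (N : Submodule k V.V₀) : InvRep k P where
  V₀ := N
  sub z := (V.sub z).comap (N.subtype.compLeft (P.Cls z))
  plus_le_minus := by
    classical
    rintro x y hyx _ ⟨h, hh, rfl⟩
    have h1 : (Pi.single (P.self x) ((h (P.self y) : N) : V.V₀) : P.Cls (P.cls x) → V.V₀) ∈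
        V.sub (P.cls x) := V.plus_le_minus x y hyx ⟨_, hh, rfl⟩
    refine Submodule.mem_comap.2 (Submodule.mem_comap.2 ?_)
    convert h1 using 1
    funext t
    by_cases ht : t = P.self x
    · subst ht; simp
    · simp [ht]

/-- The complement is ker g with the induced subspaces. The projection 1 - g ≫ f is itself a
morphism of representations, so it respects them. -/
theorem exists_iso_biprod_of_retract {V L : InvRep k P} (f : L ⟶ V) (g : V ⟶ L)
    (h : f ≫ g = 𝟙 L) : ∃ (W : InvRep k P) (i : W ⟶ V) (p : V ⟶ W),
      p ≫ i = 𝟙 V - g ≫ f ∧ Nonempty (V ≅ L ⊞ W) := by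
  have hk : ∀ x, lin (𝟙 V - g ≫ f) x ∈ LinearMap.ker (lin g) := fun x => by
    rw [LinearMap.mem_ker, ← lin_comp_apply, Preadditive.sub_comp, Category.assoc, h,
      Category.id_comp, Category.comp_id, sub_self, lin_zero_apply]
  let i : restrict V (LinearMap.ker (lin g)) ⟶ V :=
    ⟨(LinearMap.ker (lin g)).subtype, fun z t ht => ht⟩
  let p : V ⟶ restrict V (LinearMap.ker (lin g)) :=
    ⟨(lin (𝟙 V - g ≫ f)).codRestrict _ hk, fun z t ht => (𝟙 V - g ≫ f).2 z t ht⟩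
  have hpi : p ≫ i = 𝟙 V - g ≫ f := hom_ext rfl
  have hi : Mono i := mono_of_injective (Submodule.injective_subtype _)
  have hig : i ≫ g = 0 := hom_ext (LinearMap.ext fun x => x.2)
  refine ⟨_, i, p, hpi, nonempty_iso_biprod f g i p h ?_ ?_ hig (by rw [hpi]; abel)⟩
  · rw [← cancel_mono i, Category.assoc, hpi, Preadditive.comp_sub, ← Category.assoc i, hig]
    simp
  · rw [← cancel_mono i, Category.assoc, hpi, Preadditive.comp_sub, ← Category.assoc f, h]
    simp

theorem isIso_of_isSplitMono_of_indecomposable {V L : InvRep k P} (hV : Indecomposable V)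
    (hL : ¬ IsZero L) (f : L ⟶ V) [IsSplitMono f] : IsIso f := by
  obtain ⟨W, i, p, hpi, ⟨e⟩⟩ := exists_iso_biprod_of_retract f (retraction f) (IsSplitMono.id f)
  have hW : IsZero W := (hV.2 _ _ e).resolve_left hL
  rw [hW.eq_of_tgt p 0, zero_comp, eq_comm, sub_eq_zero] at hpi
  exact ⟨retraction f, IsSplitMono.id f, hpi.symm⟩

/-! ## Exact sequences -/

/-- Once the underlying sequence is exact, exactness on each class amounts to two conditions: f
reflects membership in the subspaces, and g lifts members to members. -/
theorem isEpsSequence_of {T : ShortComplex (InvRep k P)} (hinj : Function.Injective (lin T.f))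
    (hex : Function.Exact (lin T.f) (lin T.g)) (hsurj : Function.Surjective (lin T.g))
    (hf : ∀ z h, (lin T.f).compLeft (P.Cls z) h ∈ T.X₂.sub z → h ∈ T.X₁.sub z)
    (hg : ∀ z, ∀ h ∈ T.X₃.sub z, ∃ h' ∈ T.X₂.sub z, (lin T.g).compLeft (P.Cls z) h' = h) :
    IsEpsSequence T := by
  refine ⟨⟨hinj, hex, hsurj⟩, fun z => ⟨?_, ?_, ?_⟩⟩
  · intro a b hab
    refine Subtype.ext (funext fun t => hinj ?_)
    exact congrFun (congrArg Subtype.val hab) t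
  · rintro ⟨h, hh⟩
    constructor
    · intro h0
      have h1 : ∀ t, ∃ y, lin T.f y = h t := fun t =>
        (hex _).1 (congrFun (congrArg Subtype.val h0) t)
      choose y hy using h1
      have hy' : (lin T.f).compLeft (P.Cls z) y = h := funext hy
      exact ⟨⟨y, hf z y (hy' ▸ hh)⟩, Subtype.ext hy'⟩
    · rintro ⟨y, hy⟩
      refine Subtype.ext (funext fun t => (hex _).2 ⟨y.1 t, ?_⟩)
      exact congrFun (congrArg Subtype.val hy) t
  · rintro ⟨h, hh⟩
    obtain ⟨h', hh', rfl⟩ := hg z h hh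
    exact ⟨⟨h', hh'⟩, rfl⟩

theorem IsEpsSequence.isDeflation {T : ShortComplex (InvRep k P)} (hT : IsEpsSequence T) :
    IsDeflation T.g := ⟨T.X₁, T.f, T.zero, hT⟩

theorem IsEpsSequence.isInflation {T : ShortComplex (InvRep k P)} (hT : IsEpsSequence T) :
    IsInflation T.f := ⟨T.X₃, T.g, T.zero, hT⟩

theorem IsDeflation.surjective {E W : InvRep k P} {v : E ⟶ W} (hv : IsDeflation v) :
    Function.Surjective (lin v) := by
  obtain ⟨U, f, hf, h⟩ := hv
  exact h.1.2.2

theorem IsDeflation.exists_lift {E W : InvRep k P} {v : E ⟶ W} (hv : IsDeflation v) {z : P.Θ}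
    {h : P.Cls z → W.V₀} (hh : h ∈ W.sub z) :
    ∃ h' ∈ E.sub z, (lin v).compLeft (P.Cls z) h' = h := by
  obtain ⟨U, f, hf, H⟩ := hv
  obtain ⟨⟨h', hh'⟩, e⟩ := (H.2 z).2.2 ⟨h, hh⟩
  exact ⟨h', hh', congrArg Subtype.val e⟩

theorem IsInflation.injective {U E : InvRep k P} {f : U ⟶ E} (hf : IsInflation f) :
    Function.Injective (lin f) := by
  obtain ⟨W, v, hv, h⟩ := hf
  exact h.1.1

theorem IsInflation.mem_of_map_mem {U E : InvRep k P} {f : U ⟶ E} (hf : IsInflation f) {z : P.Θ}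
    {h : P.Cls z → U.V₀} (hh : (lin f).compLeft (P.Cls z) h ∈ E.sub z) : h ∈ U.sub z := by
  obtain ⟨W, v, hv, H⟩ := hf
  obtain ⟨⟨y, hy⟩, e⟩ := ((H.2 z).2.1 ⟨_, hh⟩).1 (Subtype.ext (funext fun t => by
    change lin v (lin f (h t)) = 0
    rw [← lin_comp_apply, hv, lin_zero_apply]))
  have : h = y := funext fun t => H.1.1 (congrFun (congrArg Subtype.val e) t).symm
  rwa [this]

theorem IsEpsSequence.exists_lift {T : ShortComplex (InvRep k P)} (hT : IsEpsSequence T)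
    {Z : InvRep k P} (h : Z ⟶ T.X₂) (hh : h ≫ T.g = 0) : ∃ l : Z ⟶ T.X₁, l ≫ T.f = h := by
  obtain ⟨r, hr⟩ := (lin T.f).exists_leftInverse_of_injective (LinearMap.ker_eq_bot.2 hT.1.1)
  have key : ∀ x, lin T.f (r (lin h x)) = lin h x := fun x => by
    obtain ⟨y, hy⟩ := (hT.1.2.1 (lin h x)).1 (by rw [← lin_comp_apply, hh, lin_zero_apply])
    rw [← hy, ← LinearMap.comp_apply r, hr, LinearMap.id_apply]
  refine ⟨⟨r ∘ₗ lin h, fun z t ht => hT.isInflation.mem_of_map_mem ?_⟩,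
    hom_ext (LinearMap.ext key)⟩
  refine Set.mem_of_eq_of_mem (funext fun s => key (t s)) (h.2 z t ht)

/-! ## Almost split sequences -/

/-- Non-invertible endomorphisms of X do not split, so they factor through g. If f and 1 - f both
did, their sum 1 would too, and g would split. -/
theorem IsRightAlmostSplit.hasLocalEnd {X Y : InvRep k P} {g : Y ⟶ X} (hg : IsRightAlmostSplit g) :
    HasLocalEnd X := by
  refine ⟨fun hX => hg.1 (IsSplitEpi.mk' ⟨0, hX.eq_of_tgt _ _⟩), fun f => ?_⟩
  by_contra! hc
  have key : ∀ f : X ⟶ X, ¬ IsIso f → ∃ f', f' ≫ g = f := fun f hf =>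
    hg.2 f fun _ => hf (isIso_of_isSplitEpi_endo f)
  obtain ⟨a, ha⟩ := key _ hc.1
  obtain ⟨b, hb⟩ := key _ hc.2
  exact hg.1 (IsSplitEpi.mk' ⟨a + b, by rw [Preadditive.add_comp, ha, hb]; abel⟩)

theorem IsLeftAlmostSplit.hasLocalEnd {X Y : InvRep k P} {f : X ⟶ Y} (hf : IsLeftAlmostSplit f) :
    HasLocalEnd X := by
  refine ⟨fun hX => hf.1 (IsSplitMono.mk' ⟨0, hX.eq_of_src _ _⟩), fun e => ?_⟩
  by_contra! hc
  have key : ∀ e : X ⟶ X, ¬ IsIso e → ∃ e', f ≫ e' = e := fun e he =>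
    hf.2 e fun _ => he (isIso_of_isSplitMono_endo e)
  obtain ⟨a, ha⟩ := key _ hc.1
  obtain ⟨b, hb⟩ := key _ hc.2
  exact hf.1 (IsSplitMono.mk' ⟨a + b, by rw [Preadditive.comp_add, ha, hb]; abel⟩)

theorem IsAlmostSplit.not_isEpsProjective {T : ShortComplex (InvRep k P)} (hT : IsAlmostSplit T) :
    ¬ IsEpsProjective T.X₃ := fun h => by
  obtain ⟨s, hs⟩ := h T.g hT.1.isDeflation (𝟙 _)
  exact hT.2.2.1 (IsSplitEpi.mk' ⟨s, hs⟩)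

theorem IsAlmostSplit.not_isEpsInjective {T : ShortComplex (InvRep k P)} (hT : IsAlmostSplit T) :
    ¬ IsEpsInjective T.X₁ := fun h => by
  obtain ⟨s, hs⟩ := h T.f hT.1.isInflation (𝟙 _)
  exact hT.2.1.1 (IsSplitMono.mk' ⟨s, hs⟩)

theorem IsEpsProjective.of_iso {V W : InvRep k P} (hV : IsEpsProjective V) (i : V ≅ W) :
    IsEpsProjective W := fun E X g hg f => by
  obtain ⟨h, hh⟩ := hV g hg (i.hom ≫ f)
  exact ⟨i.inv ≫ h, by rw [Category.assoc, hh, i.inv_hom_id_assoc]⟩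

theorem IsEpsInjective.of_iso {V W : InvRep k P} (hV : IsEpsInjective V) (i : V ≅ W) :
    IsEpsInjective W := fun X E f hf g => by
  obtain ⟨h, hh⟩ := hV f hf (g ≫ i.inv)
  exact ⟨h ≫ i.hom, by rw [← Category.assoc, hh, Category.assoc, i.inv_hom_id, Category.comp_id]⟩

theorem IsRightAlmostSplit.exists_lift_iso {X X' Y Y' : InvRep k P} {g : Y ⟶ X} {g' : Y' ⟶ X'}
    (hg : IsRightAlmostSplit g) (hg' : IsRightAlmostSplit g') (t : X ≅ X') :
    ∃ a : Y ⟶ Y', a ≫ g' = g ≫ t.hom :=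
  hg'.2 _ fun h => hg.1 <| IsSplitEpi.mk' ⟨t.hom ≫ section_ (g ≫ t.hom), by
    rw [← cancel_mono t.hom, Category.assoc, Category.assoc, IsSplitEpi.id, Category.id_comp,
      Category.comp_id]⟩

/-- An almost split sequence is determined by its end term. -/
theorem IsAlmostSplit.nonempty_iso {T T' : ShortComplex (InvRep k P)} (hT : IsAlmostSplit T)
    (hT' : IsAlmostSplit T') (hE : HasLocalEnd T'.X₂) (t : T.X₃ ≅ T'.X₃) : Nonempty (T ≅ T') := by
  obtain ⟨b, hb⟩ := hT.2.2.exists_lift_iso hT'.2.2 t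
  obtain ⟨a, ha⟩ := hT'.2.2.exists_lift_iso hT.2.2 t.symm
  rw [Iso.symm_hom] at ha
  -- Comparison maps exist in both directions between the middle terms. Since a ≫ b fixes T'.g ≠ 0
  -- and the middle term of T' has local endomorphisms, a ≫ b is invertible.
  have hab : (a ≫ b) ≫ T'.g = T'.g := by
    rw [Category.assoc, hb, ← Category.assoc, ha, Category.assoc, t.inv_hom_id, Category.comp_id]
  have hepi' : Epi T'.g := epi_of_surjective hT'.1.1.2.2
  have hmono : Mono T.f := mono_of_injective hT.1.1.1
  have hmono' : Mono T'.f := mono_of_injective hT'.1.1.1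
  have hiso : IsIso (a ≫ b) := (hE.2 _).resolve_right fun h => by
    have h0 : T'.g = 0 := by
      rw [← cancel_epi (𝟙 T'.X₂ - a ≫ b), Preadditive.sub_comp, hab]; simp
    exact hT'.2.2.hasLocalEnd.1 ((IsZero.iff_id_eq_zero _).2
      ((cancel_epi T'.g).1 (by rw [h0]; simp)))
  set r : T.X₂ ⟶ T'.X₂ := b ≫ inv (a ≫ b) with hr
  have har : a ≫ r = 𝟙 _ := by rw [hr, ← Category.assoc, IsIso.hom_inv_id]
  have hrg : r ≫ T'.g = T.g ≫ t.hom := by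
    have : inv (a ≫ b) ≫ T'.g = T'.g := by rw [IsIso.inv_comp_eq, hab]
    rw [hr, Category.assoc, this, hb]
  -- The idempotent 1 - r ≫ a is killed by T.g, so it equals s ≫ T.f for some s, and idempotency
  -- gives s ≫ (T.f ≫ s) = s. As T.f does not split, 1 - T.f ≫ s is invertible, whence s = 0.
  have hra : r ≫ a = 𝟙 _ := by
    obtain ⟨s, hs⟩ := hT.1.exists_lift (𝟙 _ - r ≫ a) (by
      rw [Preadditive.sub_comp, Category.assoc, ha, ← Category.assoc, hrg, Category.assoc,
        t.hom_inv_id, Category.comp_id, Category.id_comp, sub_self])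
    have hrr : (r ≫ a) ≫ (r ≫ a) = r ≫ a := by
      rw [Category.assoc, ← Category.assoc a, har, Category.id_comp]
    have hee : (s ≫ T.f) ≫ (s ≫ T.f) = s ≫ T.f := by
      rw [hs, Preadditive.sub_comp, Category.id_comp, Preadditive.comp_sub, hrr, Category.comp_id,
        sub_self, sub_zero]
    have hi : IsIso (𝟙 _ - T.f ≫ s) := (hT.2.1.hasLocalEnd.2 (T.f ≫ s)).resolve_left fun h =>
      hT.2.1.1 (IsSplitMono.mk' ⟨s ≫ inv (T.f ≫ s), by
        rw [← Category.assoc, IsIso.hom_inv_id]⟩)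
    have hs0 : s = 0 := by
      refine eq_zero_of_comp_isIso_sub hi ?_
      rw [← cancel_mono T.f]
      simpa using hee
    rw [hs0, zero_comp, eq_comm, sub_eq_zero] at hs
    exact hs.symm
  obtain ⟨u, hu⟩ := hT'.1.exists_lift (T.f ≫ r) (by
    rw [Category.assoc, hrg, ← Category.assoc, T.zero, zero_comp])
  obtain ⟨v, hv⟩ := hT.1.exists_lift (T'.f ≫ a) (by
    rw [Category.assoc, ha, ← Category.assoc, T'.zero, zero_comp])
  refine ⟨ShortComplex.isoMk ⟨u, v, ?_, ?_⟩ ⟨r, a, hra, har⟩ t hu hrg⟩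
  · rw [← cancel_mono T.f, Category.assoc, hv, ← Category.assoc, hu, Category.assoc, hra]
    simp
  · rw [← cancel_mono T'.f, Category.assoc, hu, ← Category.assoc, hv, Category.assoc, har]
    simp

end InvRep

namespace UPoset

variable {n : ℕ} {k : Type u} [Field k]

/-! # Representations of `𝔘_n` in terms of pairs -/

section

variable {M : Type*}

theorem pair_add [Add M] (j : Set.Icc 1 n) (p q p' q' : M) :
    pair j p q + pair j p' q' = pair j (p + p') (q + q') := by
  funext ⟨x, hx⟩; rcases x with i | i <;> rfl

theorem pair_smul {R : Type*} [SMul R M] (j : Set.Icc 1 n) (c : R) (p q : M) :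
    c • pair j p q = pair j (c • p) (c • q) := by
  funext ⟨x, hx⟩; rcases x with i | i <;> rfl

theorem pair_sub [Sub M] (j : Set.Icc 1 n) (p q p' q' : M) :
    pair j p q - pair j p' q' = pair j (p - p') (q - q') := by
  funext ⟨x, hx⟩; rcases x with i | i <;> rfl

theorem pair_zero [Zero M] (j : Set.Icc 1 n) : pair j (0 : M) 0 = 0 := by
  funext ⟨x, hx⟩; rcases x with i | i <;> rfl

theorem pair_injective {j : Set.Icc 1 n} {p q p' q' : M} (h : pair j p q = pair j p' q') :
    p = p' ∧ q = q' :=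
  ⟨congrFun h ⟨UPoint.a j, rfl⟩, congrFun h ⟨UPoint.b j, rfl⟩⟩

theorem compLeft_pair {M N : Type u} [AddCommGroup M] [Module k M] [AddCommGroup N] [Module k N]
    (f : M →ₗ[k] N) (j : Set.Icc 1 n) (p q : M) :
    f.compLeft ((UPoset n).Cls j) (pair j p q) = pair j (f p) (f q) := by
  funext ⟨x, hx⟩; rcases x with i | i <;> rfl

end

variable {V W Z : InvRep k (UPoset n)}

/-- `V.Rel j p q`: the pair `(p, q)` belongs to `V_{z_j}`. -/
def Rel (V : InvRep k (UPoset n)) (j : Set.Icc 1 n) (p q : V.V₀) : Prop := pair j p q ∈ V.sub j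

section Rel

variable {i j : Set.Icc 1 n} {p q p' q' : V.V₀}

theorem Rel.add (h : Rel V j p q) (h' : Rel V j p' q') : Rel V j (p + p') (q + q') := by
  unfold Rel; rw [← pair_add]; exact add_mem h h'

theorem Rel.sub (h : Rel V j p q) (h' : Rel V j p' q') : Rel V j (p - p') (q - q') := by
  unfold Rel; rw [← pair_sub]; exact sub_mem h h'

theorem Rel.smul (c : k) (h : Rel V j p q) : Rel V j (c • p) (c • q) := by
  unfold Rel; rw [← pair_smul]; exact Submodule.smul_mem _ _ h

theorem Rel.zero : Rel V j 0 0 := by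
  unfold Rel; rw [pair_zero]; exact Submodule.zero_mem _

theorem Rel.map (h : Rel V j p q) (f : V ⟶ W) : Rel W j (InvRep.lin f p) (InvRep.lin f q) := by
  unfold Rel; rw [← compLeft_pair]; exact f.2 j _ h

theorem single_mem {y x : UPoint n} (hyx : y < x) (h : Rel V y.idx p q) :
    x.elim (Rel V x.idx (y.elim p q) 0) (Rel V x.idx 0 (y.elim p q)) := by
  classical
  have key : (Pi.single ((UPoset n).self x) (y.elim p q) : (UPoset n).Cls x.idx → V.V₀) ∈
      V.sub x.idx := Submodule.mem_comap.1 (V.plus_le_minus x y hyx ⟨_, h, rfl⟩)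
  cases x with
  | a i =>
    refine Set.mem_of_eq_of_mem (funext fun ⟨t, ht⟩ => ?_) key
    rcases t with j | j <;> obtain rfl : j = i := ht
    · exact (Pi.single_eq_same (M := fun _ => V.V₀) _ _).symm
    · exact (Pi.single_eq_of_ne (M := fun _ => V.V₀)
        (fun h => by cases congrArg Subtype.val h) _).symm
  | b i =>
    refine Set.mem_of_eq_of_mem (funext fun ⟨t, ht⟩ => ?_) key
    rcases t with j | j <;> obtain rfl : j = i := ht
    · exact (Pi.single_eq_of_ne (M := fun _ => V.V₀)
        (fun h => by cases congrArg Subtype.val h) _).symm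
    · exact (Pi.single_eq_same (M := fun _ => V.V₀) _ _).symm

theorem Rel.left_of_lt (h : Rel V i p q) (hij : j.1 < i.1) : Rel V j p 0 :=
  single_mem (y := .a i) (x := .a j) ((UPoint.lt_iff _ _).2 (by simp only [UPoint.height]; omega)) h

theorem Rel.right_of_left (h : Rel V i p q) (j : Set.Icc 1 n) : Rel V j 0 p :=
  single_mem (y := .a i) (x := .b j) ((UPoint.lt_iff _ _).2 (by
    have := i.2.1; have := j.2.1; simp only [UPoint.height]; omega)) h

theorem Rel.right_of_lt (h : Rel V i p q) (hij : i.1 < j.1) : Rel V j 0 q :=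
  single_mem (y := .b i) (x := .b j) ((UPoint.lt_iff _ _).2 (by simp only [UPoint.height]; omega)) h

end Rel

/-- The space `V_{a_j}⁺` of first entries. -/
def leftSpace (V : InvRep k (UPoset n)) (j : Set.Icc 1 n) : Submodule k V.V₀ where
  carrier := {p | ∃ q, Rel V j p q}
  add_mem' := fun ⟨q, h⟩ ⟨q', h'⟩ => ⟨q + q', h.add h'⟩
  zero_mem' := ⟨0, Rel.zero⟩
  smul_mem' := fun c _ ⟨q, h⟩ => ⟨c • q, h.smul c⟩

/-- The space `V_{b_j}⁺` of second entries. -/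
def rightSpace (V : InvRep k (UPoset n)) (j : Set.Icc 1 n) : Submodule k V.V₀ where
  carrier := {q | ∃ p, Rel V j p q}
  add_mem' := fun ⟨q, h⟩ ⟨q', h'⟩ => ⟨q + q', h.add h'⟩
  zero_mem' := ⟨0, Rel.zero⟩
  smul_mem' := fun c _ ⟨q, h⟩ => ⟨c • q, h.smul c⟩

/-- The space `V_{b_j}⁻`. -/
def rightKer (V : InvRep k (UPoset n)) (j : Set.Icc 1 n) : Submodule k V.V₀ where
  carrier := {q | Rel V j 0 q}
  add_mem' := fun h h' => by simpa using Rel.add h h'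
  zero_mem' := Rel.zero
  smul_mem' := fun c _ h => by simpa using Rel.smul c h

/-! ### Linear functionals adapted to a representation -/

theorem exists_functional {N : Submodule k V.V₀} {v : V.V₀} (hv : v ∉ N) :
    ∃ φ : V.V₀ →ₗ[k] k, φ v = 1 ∧ ∀ x ∈ N, φ x = 0 := by
  obtain ⟨f, hf, hN⟩ := Submodule.exists_le_ker_of_notMem hv
  refine ⟨(f v)⁻¹ • f, inv_mul_cancel₀ hf, fun x hx => ?_⟩
  rw [LinearMap.smul_apply, LinearMap.mem_ker.1 (hN hx), smul_zero]

/-- A linear functional that vanishes on the kernel of a linear map factors through it. -/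
theorem exists_comp_eq {X Y : Type*} [AddCommGroup X] [Module k X] [AddCommGroup Y] [Module k Y]
    (f : X →ₗ[k] Y) (ψ : X →ₗ[k] k) (h : ∀ x, f x = 0 → ψ x = 0) :
    ∃ φ : Y →ₗ[k] k, ∀ x, φ (f x) = ψ x := by
  have hψ : ψ ∈ (LinearMap.ker f).dualAnnihilator :=
    (Submodule.mem_dualAnnihilator _).2 fun x hx => h x hx
  rw [← LinearMap.range_dualMap_eq_dualAnnihilator_ker] at hψ
  obtain ⟨φ, rfl⟩ := hψ
  exact ⟨φ, fun x => rfl⟩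

/-- On V_{z_i}, the functional (p, q) ↦ ψ(q) kills the kernel of the first projection, so it depends
on p alone and extends to V₀. -/
theorem exists_left_functional (i : Set.Icc 1 n) (ψ : V.V₀ →ₗ[k] k)
    (h : ∀ q, Rel V i 0 q → ψ q = 0) :
    ∃ φ : V.V₀ →ₗ[k] k, ∀ p q, Rel V i p q → φ p = ψ q := by
  obtain ⟨φ, hφ⟩ := exists_comp_eq
    (LinearMap.proj (φ := fun _ : (UPoset n).Cls i => V.V₀) ⟨.a i, rfl⟩ ∘ₗ (V.sub i).subtype)
    (ψ ∘ₗ LinearMap.proj (φ := fun _ : (UPoset n).Cls i => V.V₀) ⟨.b i, rfl⟩ ∘ₗ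
      (V.sub i).subtype) (by
      rintro ⟨t, ht⟩ h0
      obtain ⟨p, q, rfl⟩ := exists_pair i t
      obtain rfl : p = 0 := h0
      exact h q ht)
  exact ⟨φ, fun p q hpq => hφ ⟨_, hpq⟩⟩

theorem exists_right_functional (i : Set.Icc 1 n) (φ : V.V₀ →ₗ[k] k)
    (h : ∀ p, Rel V i p 0 → φ p = 0) :
    ∃ ψ : V.V₀ →ₗ[k] k, ∀ p q, Rel V i p q → φ p = ψ q := by
  obtain ⟨ψ, hψ⟩ := exists_comp_eq
    (LinearMap.proj (φ := fun _ : (UPoset n).Cls i => V.V₀) ⟨.b i, rfl⟩ ∘ₗ (V.sub i).subtype)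
    (φ ∘ₗ LinearMap.proj (φ := fun _ : (UPoset n).Cls i => V.V₀) ⟨.a i, rfl⟩ ∘ₗ
      (V.sub i).subtype) (by
      rintro ⟨t, ht⟩ h0
      obtain ⟨p, q, rfl⟩ := exists_pair i t
      obtain rfl : q = 0 := h0
      exact h p ht)
  exact ⟨ψ, fun p q hpq => (hψ ⟨_, hpq⟩).symm⟩

/-! # Morphisms from and to the representations `S` and `𝓛_{r,i}` -/

/-- `S ⟶ V`, `1 ↦ v`. -/
noncomputable def ofS (v : V.V₀) : S k n ⟶ V :=
  homMk (LinearMap.toSpanSingleton k V.V₀ v : k →ₗ[k] V.V₀) fun j (p q : k) h => by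
    obtain ⟨rfl, rfl⟩ := pair_mem_bot.1 h
    change Rel V j ((0 : k) • v) ((0 : k) • v)
    rw [zero_smul]; exact Rel.zero

/-- `𝓛_{1,i} ⟶ V`, `e ↦ v`. -/
noncomputable def ofL₁ (i : Set.Icc 1 n) (v : V.V₀) (h : Rel V i 0 v) : L₁ k n i ⟶ V :=
  homMk (LinearMap.toSpanSingleton k V.V₀ v : k →ₗ[k] V.V₀) fun j (p q : k) hpq => by
    obtain ⟨rfl, hq⟩ := mem_sub₁.1 hpq
    change Rel V j ((0 : k) • v) (q • v)
    rcases lt_trichotomy j.1 i.1 with hj | hj | hj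
    · rw [hq hj, zero_smul]; exact Rel.zero
    · obtain rfl := Subtype.ext hj
      simpa using h.smul q
    · simpa using (h.right_of_lt hj).smul q

/-- `𝓛_{2,i} ⟶ V`, `e ↦ v`. -/
noncomputable def ofL₂ (i : Set.Icc 1 n) (v : V.V₀) (h : Rel V i v 0) : L₂ k n i ⟶ V :=
  homMk (LinearMap.toSpanSingleton k V.V₀ v : k →ₗ[k] V.V₀) fun j (p q : k) hpq => by
    have hp := mem_sub₂.1 hpq
    change Rel V j (p • v) (q • v)
    have h1 : Rel V j (p • v) 0 := by
      rcases lt_trichotomy j.1 i.1 with hj | hj | hj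
      · simpa using (h.left_of_lt hj).smul p
      · obtain rfl := Subtype.ext hj
        simpa using h.smul p
      · rw [hp hj, zero_smul]; exact Rel.zero
    simpa using h1.add ((h.right_of_left j).smul q)

/-- `𝓛_{3,i} ⟶ V`, `e₁ ↦ p`, `e₂ ↦ q`. -/
noncomputable def ofL₃ (i : Set.Icc 1 n) (v w : V.V₀) (h : Rel V i v w) : L₃ k n i ⟶ V :=
  homMk (LinearMap.coprod (LinearMap.toSpanSingleton k V.V₀ v)
    (LinearMap.toSpanSingleton k V.V₀ w) : k × k →ₗ[k] V.V₀) fun j (p q : k × k) hpq => by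
    obtain ⟨h0, h1, h2, h3⟩ := mem_sub₃.1 hpq
    change Rel V j (p.1 • v + p.2 • w) (q.1 • v + q.2 • w)
    rw [h0, zero_smul, add_zero]
    -- The e₁ part of the second entry is harmless at every class, because v lies in V_{a_i}⁺ and
    -- a_i < b_j. What remains pairs multiples of v with multiples of w.
    have h4 : Rel V j 0 (q.1 • v) := by simpa using (h.right_of_left j).smul q.1
    suffices h5 : Rel V j (p.1 • v) (q.2 • w) by simpa using h4.add h5
    rcases lt_trichotomy j.1 i.1 with hj | hj | hj
    · simpa [h1 hj] using (h.left_of_lt hj).smul p.1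
    · obtain rfl := Subtype.ext hj
      simpa [h2] using h.smul p.1
    · simpa [h3 hj] using (h.right_of_lt hj).smul q.2

/-- `V ⟶ S`, given by a linear functional. -/
noncomputable def toS (φ : V.V₀ →ₗ[k] k)
    (h : ∀ j p q, Rel V j p q → φ p = 0 ∧ φ q = 0) : V ⟶ S k n :=
  homMk φ fun j p q hpq => pair_mem_bot.2 (h j p q hpq)

/-- `V ⟶ 𝓛_{1,i}`, given by a linear functional. -/
noncomputable def toL₁ (i : ℕ) (φ : V.V₀ →ₗ[k] k)
    (h : ∀ j p q, Rel V j p q → φ p = 0 ∧ (j.1 < i → φ q = 0)) : V ⟶ L₁ k n i :=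
  homMk φ fun j p q hpq => (mem_sub₁ (p := φ p) (q := φ q)).2 (h j p q hpq)

/-- `V ⟶ 𝓛_{2,i}`, given by a linear functional. -/
noncomputable def toL₂ (i : ℕ) (φ : V.V₀ →ₗ[k] k)
    (h : ∀ j p q, Rel V j p q → i < j.1 → φ p = 0) : V ⟶ L₂ k n i :=
  homMk φ fun j p q hpq => (mem_sub₂ (p := φ p) (q := φ q)).2 (h j p q hpq)

/-- `V ⟶ 𝓛_{3,i}`, given by a pair of linear functionals. -/
noncomputable def toL₃ (i : Set.Icc 1 n) (φ ψ : V.V₀ →ₗ[k] k)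
    (h : ∀ p q, Rel V i p q → φ p = ψ q) : V ⟶ L₃ k n i :=
  homMk (φ.prod ψ : V.V₀ →ₗ[k] k × k) fun j p q hpq => by
    -- The single condition at z_i suffices: a pair (p, q) at z_j yields (0, p) at z_i, and also (0,
    -- q) if j < i or (p, 0) if j > i.
    refine (mem_sub₃ (p := (φ p, ψ p)) (q := (φ q, ψ q))).2 ⟨?_, fun hj => ?_, fun hj => ?_,
      fun hj => ?_⟩
    · simpa using (h _ _ (Rel.right_of_left hpq i)).symm
    · simpa using (h _ _ (Rel.right_of_lt hpq hj)).symm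
    · obtain rfl := Subtype.ext hj
      exact h _ _ hpq
    · simpa using h _ _ (Rel.left_of_lt hpq hj)

open InvRep

theorem eq_ofS (f : S k n ⟶ V) : f = ofS (lin f (1 : k)) :=
  hom_ext (LinearMap.ext_ring (R := k) ((one_smul k _).symm))

theorem rel_L₁ {i : ℕ} {j : Set.Icc 1 n} {p q : k} :
    Rel (L₁ k n i) j p q ↔ p = 0 ∧ (j.1 < i → q = 0) := mem_sub₁

theorem rel_L₂ {i : ℕ} {j : Set.Icc 1 n} {p q : k} :
    Rel (L₂ k n i) j p q ↔ (i < j.1 → p = 0) := mem_sub₂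

theorem rel_L₃ {i : ℕ} {j : Set.Icc 1 n} {p q : k × k} : Rel (L₃ k n i) j p q ↔
    p.2 = 0 ∧ (j.1 < i → q.2 = 0) ∧ (j.1 = i → p.1 = q.2) ∧ (i < j.1 → p.1 = 0) := mem_sub₃

theorem rel_S {j : Set.Icc 1 n} {p q : k} : Rel (S k n) j p q ↔ p = 0 ∧ q = 0 := pair_mem_bot

theorem exists_eq_ofL₁ {i : Set.Icc 1 n} (f : L₁ k n i ⟶ V) : ∃ v h, f = ofL₁ i v h := by
  refine ⟨lin f (1 : k), ?_, hom_ext (LinearMap.ext_ring (R := k) ((one_smul k _).symm))⟩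
  have : Rel (L₁ k n i) i (0 : k) (1 : k) := rel_L₁.2 ⟨rfl, fun h => absurd h (lt_irrefl _)⟩
  have := this.map f
  rwa [show lin f (0 : k) = 0 from map_zero (lin f)] at this

theorem exists_eq_ofL₂ {i : Set.Icc 1 n} (f : L₂ k n i ⟶ V) : ∃ v h, f = ofL₂ i v h := by
  refine ⟨lin f (1 : k), ?_, hom_ext (LinearMap.ext_ring (R := k) ((one_smul k _).symm))⟩
  have : Rel (L₂ k n i) i (1 : k) (0 : k) := rel_L₂.2 fun h => absurd h (lt_irrefl _)
  have := this.map f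
  rwa [show lin f (0 : k) = 0 from map_zero (lin f)] at this

theorem exists_eq_ofL₃ {i : Set.Icc 1 n} (f : L₃ k n i ⟶ V) : ∃ v w h, f = ofL₃ i v w h := by
  have : Rel (L₃ k n i) i ((1, 0) : k × k) ((0, 1) : k × k) := rel_L₃.2 (by simp)
  refine ⟨lin f ((1, 0) : k × k), lin f ((0, 1) : k × k), this.map f, hom_ext ?_⟩
  refine LinearMap.prod_ext (M := k) (M₂ := k) (LinearMap.ext_ring ?_) (LinearMap.ext_ring ?_)
  · change lin f ((1, 0) : k × k) =
      (1 : k) • lin f ((1, 0) : k × k) + (0 : k) • lin f ((0, 1) : k × k)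
    rw [one_smul, zero_smul, add_zero]
  · change lin f ((0, 1) : k × k) =
      (0 : k) • lin f ((1, 0) : k × k) + (1 : k) • lin f ((0, 1) : k × k)
    rw [one_smul, zero_smul, zero_add]

end UPoset

namespace UPoset

open InvRep

variable {n : ℕ} {k : Type u} [Field k] {V W Z : InvRep k (UPoset n)}

/-! # Split monomorphisms from the representations `S` and `𝓛_{r,i}` -/

/-- The retraction is a functional equal to 1 at v and zero on V_{b_n}⁺, which contains every entry
of every pair. The criteria for 𝓛_{1,i} and 𝓛_{2,i} use the same argument with the preceding term of
the filtration, which contains all entries that the retraction must kill. -/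
theorem isSplitMono_ofS {j : Set.Icc 1 n} (hj : j.1 = n) {v : V.V₀} (hv : ∀ p, ¬ Rel V j p v) :
    IsSplitMono (ofS v) := by
  obtain ⟨φ, h1, h0⟩ := exists_functional (N := rightSpace V j) (v := v) fun ⟨p, hp⟩ => hv p hp
  refine IsSplitMono.mk' ⟨toS φ fun i p q h => ⟨h0 _ ⟨0, h.right_of_left j⟩, ?_⟩,
    hom_ext (LinearMap.ext_ring (R := k) ?_)⟩
  · rcases (show i.1 ≤ j.1 by have := i.2.2; omega).eq_or_lt with hi | hi
    · obtain rfl := Subtype.ext hi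
      exact h0 _ ⟨p, h⟩
    · exact h0 _ ⟨0, h.right_of_lt hi⟩
  · change φ ((1 : k) • v) = 1
    rw [one_smul, h1]

theorem isSplitMono_ofL₁_of_succ {i j : Set.Icc 1 n} (hij : i.1 = j.1 + 1) {v : V.V₀}
    (h : Rel V i 0 v) (hv : ∀ p, ¬ Rel V j p v) : IsSplitMono (ofL₁ i v h) := by
  obtain ⟨φ, h1, h0⟩ := exists_functional (N := rightSpace V j) (v := v) fun ⟨p, hp⟩ => hv p hp
  refine IsSplitMono.mk' ⟨toL₁ i φ fun l p q h => ⟨h0 _ ⟨0, h.right_of_left j⟩, fun hl => ?_⟩,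
    hom_ext (LinearMap.ext_ring (R := k) ?_)⟩
  · rcases (show l.1 ≤ j.1 by omega).eq_or_lt with hi | hi
    · obtain rfl := Subtype.ext hi
      exact h0 _ ⟨p, h⟩
    · exact h0 _ ⟨0, h.right_of_lt hi⟩
  · change φ ((1 : k) • v) = 1
    rw [one_smul, h1]

theorem isSplitMono_ofL₁_one {i : Set.Icc 1 n} (hi : i.1 = 1) {v : V.V₀}
    (h : Rel V i 0 v) (hv : ∀ q, ¬ Rel V i v q) : IsSplitMono (ofL₁ i v h) := by
  obtain ⟨φ, h1, h0⟩ := exists_functional (N := leftSpace V i) (v := v) fun ⟨p, hp⟩ => hv p hp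
  refine IsSplitMono.mk' ⟨toL₁ i φ fun l p q h => ⟨?_, fun hl => ?_⟩,
    hom_ext (LinearMap.ext_ring (R := k) ?_)⟩
  · rcases (show i.1 ≤ l.1 by have := l.2.1; omega).eq_or_lt with hi | hi
    · obtain rfl := Subtype.ext hi
      exact h0 _ ⟨q, h⟩
    · exact h0 _ ⟨0, h.left_of_lt hi⟩
  · have := l.2.1
    omega
  · change φ ((1 : k) • v) = 1
    rw [one_smul, h1]

theorem isSplitMono_ofL₂_of_succ {i j : Set.Icc 1 n} (hij : j.1 = i.1 + 1) {v : V.V₀}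
    (h : Rel V i v 0) (hv : ∀ q, ¬ Rel V j v q) : IsSplitMono (ofL₂ i v h) := by
  obtain ⟨φ, h1, h0⟩ := exists_functional (N := leftSpace V j) (v := v) fun ⟨p, hp⟩ => hv p hp
  refine IsSplitMono.mk' ⟨toL₂ i φ fun l p q h hl => ?_,
    hom_ext (LinearMap.ext_ring (R := k) ?_)⟩
  · rcases (show j.1 ≤ l.1 by omega).eq_or_lt with hi | hi
    · obtain rfl := Subtype.ext hi
      exact h0 _ ⟨q, h⟩
    · exact h0 _ ⟨0, h.left_of_lt hi⟩
  · change φ ((1 : k) • v) = 1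
    rw [one_smul, h1]

theorem isSplitMono_ofL₂_top {i : Set.Icc 1 n} (hi : i.1 = n) {v : V.V₀}
    (h : Rel V i v 0) (hv : v ≠ 0) : IsSplitMono (ofL₂ i v h) := by
  obtain ⟨φ, h1, -⟩ := exists_functional (N := ⊥) (v := v) hv
  refine IsSplitMono.mk' ⟨toL₂ i φ fun l p q h hl => ?_,
    hom_ext (LinearMap.ext_ring (R := k) ?_)⟩
  · have := l.2.2
    omega
  · change φ ((1 : k) • v) = 1
    rw [one_smul, h1]

/-- Since (v, 0) is not in V_{z_i}, neither is (0, w). A functional ψ with ψ(w) = 1 that vanishes on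
V_{b_i}⁻ transports along V_{z_i} to φ with φ(v) = 1. -/
theorem isSplitMono_ofL₃ {i : Set.Icc 1 n} {v w : V.V₀} (h : Rel V i v w) (hv : ¬ Rel V i v 0) :
    IsSplitMono (ofL₃ i v w h) := by
  obtain ⟨ψ, h1, h0⟩ := exists_functional (N := rightKer V i) (v := w)
    fun hw : Rel V i 0 w => hv (by simpa using h.sub hw)
  obtain ⟨φ, hφ⟩ := exists_left_functional i ψ h0
  have hψ : ∀ {p q}, Rel V i p q → ψ p = 0 := fun hpq => h0 _ (hpq.right_of_left i)
  -- Subtracting φ(w)ψ makes the first coordinate vanish at w. The relation with ψ survives because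
  -- ψ kills all first entries.
  refine IsSplitMono.mk' ⟨toL₃ i (φ - φ w • ψ) ψ fun p q hpq => ?_, hom_ext
    (LinearMap.prod_ext (M := k) (M₂ := k) (LinearMap.ext_ring ?_) (LinearMap.ext_ring ?_))⟩
  · simp [hψ hpq, hφ p q hpq]
  · change ((φ - φ w • ψ) ((1 : k) • v + (0 : k) • w), ψ ((1 : k) • v + (0 : k) • w)) =
      ((1, 0) : k × k)
    simp [hψ h, hφ v w h, h1]
  · change ((φ - φ w • ψ) ((0 : k) • v + (1 : k) • w), ψ ((0 : k) • v + (1 : k) • w)) =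
      ((0, 1) : k × k)
    simp [h1]

/-! # Factorizations of morphisms that do not split -/

theorem exists_Sinr_comp {j : Set.Icc 1 n} (hj : j.1 = n) (f : S k n ⟶ V) (hf : ¬ IsSplitMono f) :
    ∃ g, Sinr k n j ≫ g = f := by
  rw [eq_ofS f] at hf ⊢
  by_contra! hc
  refine hf (isSplitMono_ofS hj fun p hp => hc (ofL₃ j p _ hp)
    (hom_ext (LinearMap.ext_ring (R := k) ?_)))
  change (0 : k) • p + (1 : k) • lin f (1 : k) = (1 : k) • lin f (1 : k)
  rw [zero_smul, zero_add]

theorem exists_L₁inr_comp {i j : Set.Icc 1 n} (hij : i.1 = j.1 + 1) (hlt : j.1 < i.1)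
    (f : L₁ k n i ⟶ V) (hf : ¬ IsSplitMono f) : ∃ g, L₁inr k n hlt ≫ g = f := by
  obtain ⟨v, h, rfl⟩ := exists_eq_ofL₁ f
  by_contra! hc
  refine hf (isSplitMono_ofL₁_of_succ hij h fun p hp => hc (ofL₃ j p _ hp)
    (hom_ext (LinearMap.ext_ring (R := k) ?_)))
  change (0 : k) • p + (1 : k) • v = (1 : k) • v
  rw [zero_smul, zero_add]

theorem exists_L₁inl_comp {i : Set.Icc 1 n} (hi : i.1 = 1)
    (f : L₁ k n i ⟶ V) (hf : ¬ IsSplitMono f) : ∃ g, L₁inl k n i i ≫ g = f := by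
  obtain ⟨v, h, rfl⟩ := exists_eq_ofL₁ f
  by_contra! hc
  refine hf (isSplitMono_ofL₁_one hi h fun p hp => hc (ofL₃ i _ p hp)
    (hom_ext (LinearMap.ext_ring (R := k) ?_)))
  change (1 : k) • v + (0 : k) • p = (1 : k) • v
  rw [zero_smul, add_zero]

theorem exists_L₂inl_comp {i j : Set.Icc 1 n} (hij : j.1 = i.1 + 1) (hlt : i.1 < j.1)
    (f : L₂ k n i ⟶ V) (hf : ¬ IsSplitMono f) : ∃ g, L₂inl k n hlt ≫ g = f := by
  obtain ⟨v, h, rfl⟩ := exists_eq_ofL₂ f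
  by_contra! hc
  refine hf (isSplitMono_ofL₂_of_succ hij h fun p hp => hc (ofL₃ j _ p hp)
    (hom_ext (LinearMap.ext_ring (R := k) ?_)))
  change (1 : k) • v + (0 : k) • p = (1 : k) • v
  rw [zero_smul, add_zero]

theorem eq_zero_of_not_isSplitMono {i : Set.Icc 1 n} (hi : i.1 = n)
    (f : L₂ k n i ⟶ V) (hf : ¬ IsSplitMono f) : f = 0 := by
  obtain ⟨v, h, rfl⟩ := exists_eq_ofL₂ f
  by_contra hc
  refine hf (isSplitMono_ofL₂_top hi h ?_)
  rintro rfl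
  refine hc (hom_ext (LinearMap.ext_ring (R := k) ?_))
  exact smul_zero (1 : k)

/-- If the morphism does not split, the pair (v, w) decomposes inside V_{z_i} as (v, 0) + (0, w),
one summand for each target. -/
theorem exists_L₂fst_comp_add_L₁snd_comp {i : Set.Icc 1 n} (f : L₃ k n i ⟶ V)
    (hf : ¬ IsSplitMono f) : ∃ (g : L₂ k n i ⟶ V) (h : L₁ k n i ⟶ V),
      L₂fst k n le_rfl ≫ g + L₁snd k n le_rfl ≫ h = f := by
  obtain ⟨v, w, h, rfl⟩ := exists_eq_ofL₃ f
  have hv : Rel V i v 0 := by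
    by_contra hc
    exact hf (isSplitMono_ofL₃ h hc)
  have hw : Rel V i 0 w := by simpa using h.sub hv
  exact ⟨ofL₂ i v hv, ofL₁ i w hw, hom_ext (LinearMap.ext fun x => rfl)⟩

/-- Lifting the functional φ to 𝓛_{3,i} means finding ψ with φ(p) = ψ(q) on V_{z_i}. The only
obstruction is some (p, 0) in V_{z_i} with φ(p) ≠ 0, and such a p, rescaled, is a section. -/
theorem exists_comp_L₂fst {i : Set.Icc 1 n} (f : V ⟶ L₂ k n i) (hf : ¬ IsSplitEpi f) :
    ∃ g : V ⟶ L₃ k n i, g ≫ L₂fst k n le_rfl = f := by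
  let φ : V.V₀ →ₗ[k] k := lin f
  obtain ⟨ψ, hψ⟩ := exists_right_functional (V := V) i φ fun p hp => by
    by_contra hc
    have hp' : Rel V i ((φ p)⁻¹ • p) 0 := by simpa using hp.smul (φ p)⁻¹
    refine hf (IsSplitEpi.mk' ⟨ofL₂ i _ hp', hom_ext (LinearMap.ext_ring (R := k) ?_)⟩)
    change φ ((1 : k) • (φ p)⁻¹ • p) = 1
    rw [one_smul, map_smul, smul_eq_mul, inv_mul_cancel₀ hc]
  exact ⟨toL₃ i φ ψ hψ, hom_ext rfl⟩

theorem exists_comp_L₁snd {i : Set.Icc 1 n} (f : V ⟶ L₁ k n i) (hf : ¬ IsSplitEpi f) :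
    ∃ g : V ⟶ L₃ k n i, g ≫ L₁snd k n le_rfl = f := by
  let ψ : V.V₀ →ₗ[k] k := lin f
  obtain ⟨φ, hφ⟩ := exists_left_functional (V := V) i ψ fun p hp => by
    by_contra hc
    have hp' : Rel V i 0 ((ψ p)⁻¹ • p) := by simpa using hp.smul (ψ p)⁻¹
    refine hf (IsSplitEpi.mk' ⟨ofL₁ i _ hp', hom_ext (LinearMap.ext_ring (R := k) ?_)⟩)
    change ψ ((1 : k) • (ψ p)⁻¹ • p) = 1
    rw [one_smul, map_smul, smul_eq_mul, inv_mul_cancel₀ hc]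
  exact ⟨toL₃ i φ ψ hφ, hom_ext rfl⟩

/-! # Projective and injective representations -/

theorem isEpsProjective_S : IsEpsProjective (S k n) := fun E V g hg f => by
  obtain ⟨y, hy⟩ := hg.surjective (lin f (1 : k))
  refine ⟨ofS y, hom_ext (LinearMap.ext_ring (R := k) ?_)⟩
  change lin g ((1 : k) • y) = lin f (1 : k)
  rw [one_smul, hy]

theorem isEpsProjective_L₃ (i : Set.Icc 1 n) : IsEpsProjective (L₃ k n i) := fun E V g hg f => by
  obtain ⟨v, w, h, rfl⟩ := exists_eq_ofL₃ f
  obtain ⟨t, ht, e⟩ := hg.exists_lift h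
  obtain ⟨p, q, rfl⟩ := exists_pair i t
  rw [compLeft_pair] at e
  obtain ⟨rfl, rfl⟩ := pair_injective e
  refine ⟨ofL₃ i p q ht, hom_ext (LinearMap.ext fun x => ?_)⟩
  change lin g (x.1 • p + x.2 • q) = x.1 • lin g p + x.2 • lin g q
  rw [map_add, map_smul, map_smul]

theorem isEpsInjective_L₂ : IsEpsInjective (L₂ k n n) := fun V E f hf g => by
  obtain ⟨φ, hφ⟩ := exists_comp_eq (lin f) (lin g : V.V₀ →ₗ[k] k) fun x hx => by
    rw [hf.injective (hx.trans (map_zero _).symm)]; exact map_zero (lin g)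
  exact ⟨toL₂ n φ fun j p q _ hj => absurd j.2.2 (not_le.2 hj), hom_ext (LinearMap.ext hφ)⟩

/-- The subspace `V_{z_j}`, as a space of pairs. -/
def relSpace (V : InvRep k (UPoset n)) (j : Set.Icc 1 n) : Submodule k (V.V₀ × V.V₀) where
  carrier := {x | Rel V j x.1 x.2}
  add_mem' := fun h h' => Rel.add h h'
  zero_mem' := Rel.zero
  smul_mem' := fun c _ h => Rel.smul c h

theorem isEpsInjective_L₃ (i : Set.Icc 1 n) : IsEpsInjective (L₃ k n i) := fun V E f hf g => by
  let φ : V.V₀ →ₗ[k] k := LinearMap.fst k k k ∘ₗ (lin g : V.V₀ →ₗ[k] k × k)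
  let ψ : V.V₀ →ₗ[k] k := LinearMap.snd k k k ∘ₗ (lin g : V.V₀ →ₗ[k] k × k)
  have hφψ : ∀ p q, Rel V i p q → φ p = ψ q := fun p q h => (rel_L₃.1 (h.map g)).2.2.1 rfl
  -- The functional φ(p) - ψ(q) on V₀ × V₀ kills V_{z_i}, which for an inflation is the full
  -- preimage of E_{z_i}. Hence it extends to E₀ × E₀ modulo E_{z_i}; the two components, with a
  -- sign, form the desired morphism.
  obtain ⟨Φ, hΦ⟩ := exists_comp_eq ((relSpace E i).mkQ ∘ₗ (lin f).prodMap (lin f))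
    (φ ∘ₗ LinearMap.fst k _ _ - ψ ∘ₗ LinearMap.snd k _ _) fun x hx => by
      have h1 : Rel E i (lin f x.1) (lin f x.2) := (Submodule.Quotient.mk_eq_zero (relSpace E i)).1 hx
      have h2 : Rel V i x.1 x.2 := hf.mem_of_map_mem (by rw [compLeft_pair]; exact h1)
      exact sub_eq_zero.2 (hφψ _ _ h2)
  let Φ' : E.V₀ × E.V₀ →ₗ[k] k := Φ ∘ₗ (relSpace E i).mkQ
  have hΦ' : ∀ p q, Φ' (lin f p, lin f q) = φ p - ψ q := fun p q => hΦ (p, q)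
  refine ⟨toL₃ i (Φ' ∘ₗ LinearMap.inl k _ _) (-(Φ' ∘ₗ LinearMap.inr k _ _)) fun p q h => ?_,
    hom_ext (LinearMap.ext fun x => ?_)⟩
  · have h0 : Φ' (p, q) = 0 := by
      have h1 : (relSpace E i).mkQ (p, q) = 0 := (Submodule.Quotient.mk_eq_zero _).2 h
      exact (congrArg Φ h1).trans (map_zero Φ)
    rw [← sub_eq_zero, ← h0]
    simp [← map_add]
  · have h1 := hΦ' x 0
    have h2 := hΦ' 0 x
    rw [map_zero, map_zero, sub_zero] at h1
    rw [map_zero, map_zero, zero_sub] at h2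
    change (Φ' (lin f x, 0), -(Φ' (0, lin f x))) = (φ x, ψ x)
    rw [h1, h2, neg_neg]

/-! # Classification of the indecomposable representations -/

theorem not_isZero_toRep : ∀ v : Vertex n, ¬ IsZero (v.toRep k)
  | .S => fun h => one_ne_zero (α := k) (isZero_iff.1 h (1 : k))
  | .L₁ _ => fun h => one_ne_zero (α := k) (isZero_iff.1 h (1 : k))
  | .L₂ _ => fun h => one_ne_zero (α := k) (isZero_iff.1 h (1 : k))
  | .L₃ _ => fun h => one_ne_zero (congrArg Prod.fst (isZero_iff.1 h ((1, 0) : k × k)))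

theorem exists_smul_sub_sq_eq_zero (v : Vertex n) (e : v.toRep k ⟶ v.toRep k) :
    ∃ c : k, (c • 𝟙 (v.toRep k) - e) ≫ (c • 𝟙 (v.toRep k) - e) = 0 := by
  cases v with
  | L₃ i =>
    obtain ⟨v, w, h, rfl⟩ := exists_eq_ofL₃ (V := L₃ k n i) e
    obtain ⟨v₁, v₂⟩ := (v : k × k)
    obtain ⟨w₁, w₂⟩ := (w : k × k)
    -- An endomorphism of 𝓛_{3,i} sends e₁ to v₁e₁ and e₂ to w₁e₁ + v₁e₂: a scalar plus a
    -- square-zero map.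
    obtain ⟨hv : v₂ = 0, -, hw, -⟩ := rel_L₃.1 h
    obtain rfl : v₁ = w₂ := hw rfl
    subst hv
    refine ⟨v₁, hom_ext (LinearMap.ext fun x => ?_)⟩
    have key : ∀ x : k × k, lin (v₁ • 𝟙 (L₃ k n i) - ofL₃ (V := L₃ k n i) i _ _ h) x =
        ((-(x.2 * w₁), 0) : k × k) := by
      intro x
      refine (lin_sub_apply _ _ _).trans ?_
      change (v₁ • x.1 - (x.1 • v₁ + x.2 • w₁), v₁ • x.2 - (x.1 • 0 + x.2 • v₁)) = _
      simp only [smul_eq_mul]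
      ext <;> simp <;> ring
    refine (lin_comp_apply _ _ _).trans ?_
    refine (congrArg _ (key x)).trans ((key _).trans ?_)
    simp; rfl
  | S | L₁ i | L₂ i =>
    let c : k := lin e (1 : k)
    refine ⟨c, ?_⟩
    have h0 : c • 𝟙 (Vertex.toRep k _) - e = 0 := by
      refine hom_ext (LinearMap.ext_ring (R := k) ?_)
      refine (lin_sub_apply _ _ _).trans (sub_eq_zero.2 ?_)
      exact mul_one c
    rw [h0, zero_comp]

theorem hasLocalEnd_toRep (v : Vertex n) : HasLocalEnd (v.toRep k) :=
  hasLocalEnd_of_sq_zero (not_isZero_toRep v) (exists_smul_sub_sq_eq_zero v)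

theorem exists_smul_sub_mem_catRad (v : Vertex n) (e : v.toRep k ⟶ v.toRep k) :
    ∃ c : k, c • 𝟙 (v.toRep k) - e ∈ catRad k (v.toRep k) (v.toRep k) :=
  (exists_smul_sub_sq_eq_zero v e).imp fun _ h => mem_catRad_of_sq_zero (hasLocalEnd_toRep v) h

theorem exists_iso_toRep (hn : 1 ≤ n) (hV : Indecomposable V) :
    ∃ v : Vertex n, Nonempty (V ≅ v.toRep k) := by
  by_contra! hc
  have hns : ∀ (v : Vertex n) (f : v.toRep k ⟶ V), ¬ IsSplitMono f := fun v f hf =>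
    have := isIso_of_isSplitMono_of_indecomposable hV (not_isZero_toRep v) f
    (hc v).false (asIso f).symm
  -- With no summand 𝓛_{3,i}, each V_{z_i} splits as V_{a_i}⁻ ⊕ V_{b_i}⁻. The excluded summands then
  -- push an arbitrary vector down the filtration: S and the 𝓛_{1,i} with i ≥ 2 through the b_i from
  -- n to 1, then 𝓛_{1,1} and the 𝓛_{2,i} with i < n through the a_i from 1 to n. Finally 𝓛_{2,n}
  -- forces the vector to be zero.
  have h3 : ∀ {i p q}, Rel V i p q → Rel V i p 0 := fun {i p q} h => by
    by_contra h'
    exact hns (.L₃ i) _ (isSplitMono_ofL₃ h h')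
  have h3' : ∀ {i p q}, Rel V i p q → Rel V i 0 q := fun h => by simpa using h.sub (h3 h)
  have hright : ∀ (m : ℕ) (i : Set.Icc 1 n), i.1 + m = n → ∀ v, Rel V i 0 v := by
    intro m
    induction m with
    | zero =>
      intro i hi v
      by_contra h'
      exact hns .S _ (isSplitMono_ofS hi fun p hp => h' (h3' hp))
    | succ m ih =>
      intro i hi v
      by_contra h'
      have hj : i.1 + 1 ∈ Set.Icc 1 n := ⟨by omega, by omega⟩
      exact hns (.L₁ ⟨_, hj⟩) _ (isSplitMono_ofL₁_of_succ (j := i) rfl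
        (ih ⟨_, hj⟩ (by simp only; omega) v) fun p hp => h' (h3' hp))
  have hleft : ∀ (m : ℕ) (i : Set.Icc 1 n), i.1 = m + 1 → ∀ v, Rel V i v 0 := by
    intro m
    induction m with
    | zero =>
      intro i hi v
      by_contra h'
      exact hns (.L₁ i) _ (isSplitMono_ofL₁_one hi (hright (n - 1) i (by omega) v)
        fun q hq => h' (h3 hq))
    | succ m ih =>
      intro i hi v
      by_contra h'
      have hj : m + 1 ∈ Set.Icc 1 n := ⟨by omega, by have := i.2.2; omega⟩
      exact hns (.L₂ ⟨_, hj⟩) _ (isSplitMono_ofL₂_of_succ (j := i) hi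
        (ih ⟨_, hj⟩ rfl v) fun p hp => h' (h3 hp))
  refine hV.1 (isZero_iff.2 fun v => ?_)
  by_contra h'
  exact hns (.L₂ ⟨n, hn, le_rfl⟩) _ (isSplitMono_ofL₂_top rfl
    (hleft (n - 1) ⟨n, hn, le_rfl⟩ (by simp only; omega) v) h')

/-! # The vertices are pairwise non-isomorphic -/

/-- The space `V_{a_j}⁻` is nonzero. -/
def HasLeft (V : InvRep k (UPoset n)) (j : Set.Icc 1 n) : Prop := ∃ p : V.V₀, p ≠ 0 ∧ Rel V j p 0

/-- The space `V_{b_j}⁻` is nonzero. -/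
def HasRight (V : InvRep k (UPoset n)) (j : Set.Icc 1 n) : Prop := ∃ q : V.V₀, q ≠ 0 ∧ Rel V j 0 q

theorem lin_hom_ne_zero (e : V ≅ W) {x : V.V₀} (hx : x ≠ 0) : lin e.hom x ≠ 0 := fun h => hx <| by
  rw [← lin_id_apply x, ← e.hom_inv_id, lin_comp_apply, h, map_zero]

theorem HasLeft.of_iso {j : Set.Icc 1 n} (e : V ≅ W) : HasLeft V j → HasLeft W j :=
  fun ⟨p, hp, h⟩ => ⟨_, lin_hom_ne_zero e hp, by simpa using h.map e.hom⟩

theorem HasRight.of_iso {j : Set.Icc 1 n} (e : V ≅ W) : HasRight V j → HasRight W j :=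
  fun ⟨p, hp, h⟩ => ⟨_, lin_hom_ne_zero e hp, by simpa using h.map e.hom⟩

theorem finrank_eq_of_iso (e : V ≅ W) : Module.finrank k V.V₀ = Module.finrank k W.V₀ :=
  LinearEquiv.finrank_eq (LinearEquiv.ofLinearMap (lin e.hom) (lin e.inv)
    (congrArg lin e.inv_hom_id) (congrArg lin e.hom_inv_id))

theorem finrank_toRep : ∀ v : Vertex n, Module.finrank k (v.toRep k).V₀ =
    match v with
    | .L₃ _ => 2
    | _ => 1
  | .S => Module.finrank_self k
  | .L₁ _ => Module.finrank_self k
  | .L₂ _ => Module.finrank_self k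
  | .L₃ _ => (Module.finrank_prod (R := k) (M := k) (M' := k)).trans (by rw [Module.finrank_self])

theorem not_hasLeft_S (j : Set.Icc 1 n) : ¬ HasLeft (S k n) j :=
  fun ⟨_, hp, h⟩ => hp (rel_S.1 h).1

theorem not_hasRight_S (j : Set.Icc 1 n) : ¬ HasRight (S k n) j :=
  fun ⟨_, hp, h⟩ => hp (rel_S.1 h).2

theorem not_hasLeft_L₁ (i : ℕ) (j : Set.Icc 1 n) : ¬ HasLeft (L₁ k n i) j :=
  fun ⟨_, hp, h⟩ => hp (rel_L₁.1 h).1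

theorem hasRight_L₁ {i : ℕ} {j : Set.Icc 1 n} : HasRight (L₁ k n i) j ↔ i ≤ j.1 :=
  ⟨fun ⟨_, hp, h⟩ => not_lt.1 fun hlt => hp ((rel_L₁.1 h).2 hlt),
    fun h => ⟨(1 : k), one_ne_zero (α := k), rel_L₁.2 ⟨rfl, fun h' => absurd h (not_le.2 h')⟩⟩⟩

theorem hasLeft_L₂ {i : ℕ} {j : Set.Icc 1 n} : HasLeft (L₂ k n i) j ↔ j.1 ≤ i :=
  ⟨fun ⟨_, hp, h⟩ => not_lt.1 fun hlt => hp ((rel_L₂ (k := k)).1 h hlt),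
    fun h => ⟨(1 : k), one_ne_zero (α := k), rel_L₂.2 fun h' => absurd h (not_le.2 h')⟩⟩

theorem hasLeft_L₃ {i : ℕ} {j : Set.Icc 1 n} : HasLeft (L₃ k n i) j ↔ j.1 < i := by
  constructor
  · rintro ⟨p, hp, h⟩
    obtain ⟨h0, -, h1, h2⟩ := rel_L₃.1 h
    by_contra! hc
    refine hp (Prod.ext ?_ h0)
    rcases hc.eq_or_lt with hc | hc
    · exact h1 hc.symm
    · exact h2 hc
  · intro h
    refine ⟨((1, 0) : k × k), fun h0 => one_ne_zero (congrArg Prod.fst h0), rel_L₃.2 ?_⟩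
    exact ⟨rfl, fun _ => rfl, fun h' => absurd h' h.ne, fun h' => absurd h h'.not_gt⟩

/-- The dimension of V₀ isolates the 𝓛_{3,i}; the sets of j with V_{a_j}⁻ ≠ 0 or V_{b_j}⁻ ≠ 0 then
separate the types and recover the index. -/
theorem eq_of_iso_toRep {v w : Vertex n} (e : v.toRep k ≅ w.toRep k) : v = w := by
  have hd := finrank_eq_of_iso e
  have hl : ∀ j, HasLeft (v.toRep k) j ↔ HasLeft (w.toRep k) j := fun j =>
    ⟨HasLeft.of_iso e, HasLeft.of_iso e.symm⟩
  have hr : ∀ j, HasRight (v.toRep k) j ↔ HasRight (w.toRep k) j := fun j =>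
    ⟨HasRight.of_iso e, HasRight.of_iso e.symm⟩
  clear e
  rw [finrank_toRep, finrank_toRep] at hd
  rcases v with _ | i | i | i <;> rcases w with _ | j | j | j
  · rfl
  · exact absurd ((hr j).2 (hasRight_L₁.2 le_rfl)) (not_hasRight_S _)
  · exact absurd ((hl j).2 (hasLeft_L₂.2 le_rfl)) (not_hasLeft_S _)
  · cases hd
  · exact absurd ((hr i).1 (hasRight_L₁.2 le_rfl)) (not_hasRight_S _)
  · exact congrArg _ (Subtype.ext (le_antisymm
      (hasRight_L₁.1 ((hr j).2 (hasRight_L₁.2 le_rfl)))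
      (hasRight_L₁.1 ((hr i).1 (hasRight_L₁.2 le_rfl)))))
  · exact absurd ((hl j).2 (hasLeft_L₂.2 le_rfl)) (not_hasLeft_L₁ _ _)
  · cases hd
  · exact absurd ((hl i).1 (hasLeft_L₂.2 le_rfl)) (not_hasLeft_S _)
  · exact absurd ((hl i).1 (hasLeft_L₂.2 le_rfl)) (not_hasLeft_L₁ _ _)
  · exact congrArg _ (Subtype.ext (le_antisymm
      (hasLeft_L₂.1 ((hl i).1 (hasLeft_L₂.2 le_rfl)))
      (hasLeft_L₂.1 ((hl j).2 (hasLeft_L₂.2 le_rfl)))))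
  · cases hd
  · cases hd
  · cases hd
  · cases hd
  · have h1 : i.1 < i.1 ↔ i.1 < j.1 := hasLeft_L₃.symm.trans ((hl i).trans hasLeft_L₃)
    have h2 : j.1 < i.1 ↔ j.1 < j.1 := hasLeft_L₃.symm.trans ((hl j).trans hasLeft_L₃)
    exact congrArg _ (Subtype.ext (by omega))

theorem not_isSplitMono_of_ne {v w : Vertex n} (h : v ≠ w) (f : v.toRep k ⟶ w.toRep k) :
    ¬ IsSplitMono f := fun _ =>
  have := isIso_of_isSplitMono_of_hasLocalEnd (hasLocalEnd_toRep w) (not_isZero_toRep v) f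
  h (eq_of_iso_toRep (asIso f))

theorem not_isSplitEpi_of_ne {v w : Vertex n} (h : v ≠ w) (f : v.toRep k ⟶ w.toRep k) :
    ¬ IsSplitEpi f := fun _ =>
  have := isIso_of_isSplitEpi_of_hasLocalEnd (hasLocalEnd_toRep v) (not_isZero_toRep w) f
  h (eq_of_iso_toRep (asIso f))

end UPoset

namespace UPoset

open InvRep

variable {n : ℕ} {k : Type u} [Field k]

/-! # The almost split sequences -/

theorem isEpsSequence_of_rel {T : ShortComplex (InvRep k (UPoset n))}
    (hinj : Function.Injective (lin T.f)) (hex : Function.Exact (lin T.f) (lin T.g))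
    (hsurj : Function.Surjective (lin T.g))
    (hf : ∀ j p q, Rel T.X₂ j (lin T.f p) (lin T.f q) → Rel T.X₁ j p q)
    (hg : ∀ j p q, Rel T.X₃ j p q → ∃ p' q', Rel T.X₂ j p' q' ∧ lin T.g p' = p ∧ lin T.g q' = q) :
    IsEpsSequence T := by
  refine isEpsSequence_of hinj hex hsurj (fun z h hh => ?_) fun z h hh => ?_
  · obtain ⟨p, q, rfl⟩ := exists_pair z h
    rw [compLeft_pair] at hh
    exact hf z p q hh
  · obtain ⟨p, q, rfl⟩ := exists_pair z h
    obtain ⟨p', q', h', rfl, rfl⟩ := hg z p q hh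
    exact ⟨pair z p' q', h', compLeft_pair _ _ _ _⟩

variable (k) in
theorem inl_injective : Function.Injective (LinearMap.inl k k k) := LinearMap.inl_injective

variable (k) in
theorem inr_injective : Function.Injective (LinearMap.inr k k k) := LinearMap.inr_injective

variable (k) in
theorem fst_surjective : Function.Surjective (LinearMap.fst k k k) := LinearMap.fst_surjective

variable (k) in
theorem snd_surjective : Function.Surjective (LinearMap.snd k k k) := LinearMap.snd_surjective

variable (k) in
theorem exact_inl_snd : Function.Exact (LinearMap.inl k k k) (LinearMap.snd k k k) := fun x =>
  ⟨fun h => ⟨x.1, Prod.ext rfl h.symm⟩, by rintro ⟨y, rfl⟩; rfl⟩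

variable (k) in
theorem exact_inr_fst : Function.Exact (LinearMap.inr k k k) (LinearMap.fst k k k) := fun x =>
  ⟨fun h => ⟨x.2, Prod.ext h.symm rfl⟩, by rintro ⟨y, rfl⟩; rfl⟩

theorem exists_rel_L₃_of_rel_L₁ {i : ℕ} {j : Set.Icc 1 n} {p q : k} (h : Rel (L₁ k n i) j p q) :
    ∃ p' q' : k × k, Rel (L₃ k n i) j p' q' ∧ p'.2 = p ∧ q'.2 = q := by
  obtain ⟨rfl, h1⟩ := rel_L₁.1 h
  -- At z_i an e₂ in the second entry must be accompanied by e₁ in the first, so the lift of (0, q)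
  -- acquires q e₁ there.
  refine ⟨(if j.1 = i then q else 0, 0), (0, q), rel_L₃.2 ⟨rfl, h1, fun h => if_pos h,
    fun h => if_neg h.ne'⟩, rfl, rfl⟩

theorem exists_rel_L₃_of_rel_L₂ {i : ℕ} {j : Set.Icc 1 n} {p q : k} (h : Rel (L₂ k n i) j p q) :
    ∃ p' q' : k × k, Rel (L₃ k n i) j p' q' ∧ p'.1 = p ∧ q'.1 = q := by
  have h1 := (rel_L₂ (k := k)).1 h
  refine ⟨(p, 0), (q, if j.1 = i then p else 0), rel_L₃.2 ⟨rfl, fun h => if_neg h.ne,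
    fun h => (if_pos h).symm, h1⟩, rfl, rfl⟩

theorem isEpsSequence_seq₁₁ : IsEpsSequence (seq₁₁ k n) :=
  isEpsSequence_of_rel (inl_injective k) (exact_inl_snd k) (snd_surjective k)
    (fun j p q h => by
      obtain ⟨-, -, h1, h2⟩ := rel_L₃.1 h
      refine (rel_L₁ (k := k)).2 ⟨?_, fun hj => absurd j.2.1 (not_le.2 hj)⟩
      rcases (show 1 ≤ j.1 from j.2.1).eq_or_lt with hj | hj
      · exact h1 hj.symm
      · exact h2 hj)
    fun j p q h => exists_rel_L₃_of_rel_L₁ h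

theorem isEpsSequence_seq₁₂ (i : ℕ) : IsEpsSequence (seq₁₂ k n i) :=
  isEpsSequence_of_rel (inr_injective k) (exact_inr_fst k) (fst_surjective k)
    (fun j p q h => by
      obtain ⟨h0, h1, h2, -⟩ := rel_L₃.1 h
      refine (rel_L₁ (k := k)).2 ⟨h0, fun hj => ?_⟩
      rcases (Nat.lt_succ_iff.1 hj).eq_or_lt with hj | hj
      · exact (h2 hj).symm
      · exact h1 hj)
    fun j p q h => exists_rel_L₃_of_rel_L₂ h

theorem isEpsSequence_seq₂₁ (i : ℕ) : IsEpsSequence (seq₂₁ k n i) :=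
  isEpsSequence_of_rel (inl_injective k) (exact_inl_snd k) (snd_surjective k)
    (fun j p q h => by
      obtain ⟨-, -, h1, h2⟩ := rel_L₃.1 h
      refine (rel_L₂ (k := k)).2 fun hj => ?_
      rcases (Nat.succ_le_iff.2 hj).eq_or_lt with hj | hj
      · exact h1 hj.symm
      · exact h2 hj)
    fun j p q h => exists_rel_L₃_of_rel_L₁ h

theorem isEpsSequence_seqS : IsEpsSequence (seqS k n) :=
  isEpsSequence_of_rel (inr_injective k) (exact_inr_fst k) (fst_surjective k)
    (fun j p q h => by
      obtain ⟨h0, h1, h2, -⟩ := rel_L₃.1 h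
      refine (rel_S (k := k)).2 ⟨h0, ?_⟩
      rcases (show j.1 ≤ n from j.2.2).eq_or_lt with hj | hj
      · exact (h2 hj).symm
      · exact h1 hj)
    fun j p q h => exists_rel_L₃_of_rel_L₂ h

theorem isAlmostSplit_seq₁₁ (hn : 1 ≤ n) : IsAlmostSplit (seq₁₁ k n) := by
  let i : Set.Icc 1 n := ⟨1, le_rfl, hn⟩
  exact ⟨isEpsSequence_seq₁₁,
    ⟨not_isSplitMono_of_ne (v := .L₁ i) (w := .L₃ i) (by simp) _,
      fun _ h hh => exists_L₁inl_comp (i := i) rfl h hh⟩,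
    ⟨not_isSplitEpi_of_ne (v := .L₃ i) (w := .L₁ i) (by simp) _,
      fun _ h hh => exists_comp_L₁snd (i := i) h hh⟩⟩

theorem isAlmostSplit_seq₁₂ {i : ℕ} (hi : 1 ≤ i) (hi' : i + 1 ≤ n) :
    IsAlmostSplit (seq₁₂ k n i) := by
  let i₀ : Set.Icc 1 n := ⟨i, hi, by omega⟩
  let i₁ : Set.Icc 1 n := ⟨i + 1, by omega, hi'⟩
  exact ⟨isEpsSequence_seq₁₂ i,
    ⟨not_isSplitMono_of_ne (v := .L₁ i₁) (w := .L₃ i₀) (by simp) _,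
      fun _ h hh => exists_L₁inr_comp (i := i₁) (j := i₀) rfl i.lt_succ_self h hh⟩,
    ⟨not_isSplitEpi_of_ne (v := .L₃ i₀) (w := .L₂ i₀) (by simp) _,
      fun _ h hh => exists_comp_L₂fst (i := i₀) h hh⟩⟩

theorem isAlmostSplit_seq₂₁ {i : ℕ} (hi : 1 ≤ i) (hi' : i + 1 ≤ n) :
    IsAlmostSplit (seq₂₁ k n i) := by
  let i₀ : Set.Icc 1 n := ⟨i, hi, by omega⟩
  let i₁ : Set.Icc 1 n := ⟨i + 1, by omega, hi'⟩
  exact ⟨isEpsSequence_seq₂₁ i,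
    ⟨not_isSplitMono_of_ne (v := .L₂ i₀) (w := .L₃ i₁) (by simp) _,
      fun _ h hh => exists_L₂inl_comp (i := i₀) (j := i₁) rfl i.lt_succ_self h hh⟩,
    ⟨not_isSplitEpi_of_ne (v := .L₃ i₁) (w := .L₁ i₁) (by simp) _,
      fun _ h hh => exists_comp_L₁snd (i := i₁) h hh⟩⟩

theorem isAlmostSplit_seqS (hn : 1 ≤ n) : IsAlmostSplit (seqS k n) := by
  let i : Set.Icc 1 n := ⟨n, hn, le_rfl⟩
  exact ⟨isEpsSequence_seqS,
    ⟨not_isSplitMono_of_ne (v := .S) (w := .L₃ i) (by simp) _,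
      fun _ h hh => exists_Sinr_comp (j := i) rfl h hh⟩,
    ⟨not_isSplitEpi_of_ne (v := .L₃ i) (w := .L₂ i) (by simp) _,
      fun _ h hh => exists_comp_L₂fst (i := i) h hh⟩⟩

/-- The end term has local endomorphisms, hence is a vertex, and it is not projective, hence is some
𝓛_{1,i} or 𝓛_{2,i}. Exactly one listed sequence ends there, and its middle term 𝓛_{3,i} has local
endomorphisms as the uniqueness argument requires. -/
theorem iso_of_isAlmostSplit (hn : 1 ≤ n) {T : ShortComplex (InvRep k (UPoset n))}
    (hT : IsAlmostSplit T) : Nonempty (T ≅ seq₁₁ k n) ∨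
      (∃ i, 1 ≤ i ∧ i + 1 ≤ n ∧ Nonempty (T ≅ seq₁₂ k n i)) ∨
      (∃ i, 1 ≤ i ∧ i + 1 ≤ n ∧ Nonempty (T ≅ seq₂₁ k n i)) ∨ Nonempty (T ≅ seqS k n) := by
  obtain ⟨v, ⟨e⟩⟩ := exists_iso_toRep hn hT.2.2.hasLocalEnd.indecomposable
  rcases v with _ | ⟨i, hi, hi'⟩ | ⟨i, hi, hi'⟩ | i
  · exact absurd (isEpsProjective_S.of_iso e.symm) hT.not_isEpsProjective
  · obtain _ | _ | i := i
    · omega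
    · exact Or.inl (hT.nonempty_iso (isAlmostSplit_seq₁₁ hn)
        (hasLocalEnd_toRep (.L₃ ⟨1, hi, hi'⟩)) e)
    · exact Or.inr (Or.inr (Or.inl ⟨i + 1, by omega, hi', hT.nonempty_iso
        (isAlmostSplit_seq₂₁ (by omega) hi') (hasLocalEnd_toRep (.L₃ ⟨i + 1 + 1, hi, hi'⟩)) e⟩))
  · rcases hi'.eq_or_lt with rfl | hlt
    · exact Or.inr (Or.inr (Or.inr (hT.nonempty_iso (isAlmostSplit_seqS hn)
        (hasLocalEnd_toRep (.L₃ ⟨i, hi, hi'⟩)) e)))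
    · exact Or.inr (Or.inl ⟨i, hi, hlt, hT.nonempty_iso
        (isAlmostSplit_seq₁₂ hi hlt) (hasLocalEnd_toRep (.L₃ ⟨i, hi, hi'⟩)) e⟩)
  · exact absurd ((isEpsProjective_L₃ i).of_iso e.symm) hT.not_isEpsProjective

/-! # Projective and injective vertices -/

theorem not_isEpsProjective_L₁ (i : Set.Icc 1 n) : ¬ IsEpsProjective (L₁ k n i) := by
  obtain ⟨_ | _ | i, hi, hi'⟩ := i
  · omega
  · exact (isAlmostSplit_seq₁₁ hi').not_isEpsProjective
  · exact (isAlmostSplit_seq₂₁ (i := i + 1) (by omega) hi').not_isEpsProjective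

theorem not_isEpsProjective_L₂ (i : Set.Icc 1 n) : ¬ IsEpsProjective (L₂ k n i) := by
  obtain ⟨i, hi, hi'⟩ := i
  rcases hi'.eq_or_lt with rfl | hlt
  · exact (isAlmostSplit_seqS hi).not_isEpsProjective
  · exact (isAlmostSplit_seq₁₂ hi hlt).not_isEpsProjective

theorem not_isEpsInjective_L₁ (i : Set.Icc 1 n) : ¬ IsEpsInjective (L₁ k n i) := by
  obtain ⟨_ | _ | i, hi, hi'⟩ := i
  · omega
  · exact (isAlmostSplit_seq₁₁ hi').not_isEpsInjective
  · exact (isAlmostSplit_seq₁₂ (i := i + 1) (by omega) hi').not_isEpsInjective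

theorem not_isEpsInjective_L₂ {i : ℕ} (hi : 1 ≤ i) (hlt : i < n) : ¬ IsEpsInjective (L₂ k n i) :=
  (isAlmostSplit_seq₂₁ hi hlt).not_isEpsInjective

theorem isRepresentativeFamily_projective (hn : 1 ≤ n) : IsRepresentativeFamily
    (fun V : InvRep k (UPoset n) => Indecomposable V ∧ V.IsEpsProjective)
    (fun r : Option (Set.Icc 1 n) => r.elim (S k n) (fun r => L₃ k n r)) := by
  refine ⟨?_, ?_, ?_⟩
  · rintro (_ | i)
    · exact ⟨(hasLocalEnd_toRep .S).indecomposable, isEpsProjective_S⟩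
    · exact ⟨(hasLocalEnd_toRep (.L₃ i)).indecomposable, isEpsProjective_L₃ i⟩
  · rintro (_ | i) (_ | j) ⟨e⟩
    · rfl
    · cases eq_of_iso_toRep (v := .S) (w := .L₃ j) e
    · cases eq_of_iso_toRep (v := .L₃ i) (w := .S) e
    · cases eq_of_iso_toRep (v := .L₃ i) (w := .L₃ j) e
      rfl
  · rintro V ⟨hV, hP⟩
    obtain ⟨_ | i | i | i, ⟨e⟩⟩ := exists_iso_toRep hn hV
    · exact ⟨none, ⟨e⟩⟩
    · exact absurd (hP.of_iso e) (not_isEpsProjective_L₁ i)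
    · exact absurd (hP.of_iso e) (not_isEpsProjective_L₂ i)
    · exact ⟨some i, ⟨e⟩⟩

theorem isRepresentativeFamily_injective (hn : 1 ≤ n) : IsRepresentativeFamily
    (fun V : InvRep k (UPoset n) => Indecomposable V ∧ V.IsEpsInjective)
    (fun r : Option (Set.Icc 1 n) => r.elim (L₂ k n n) (fun r => L₃ k n r)) := by
  refine ⟨?_, ?_, ?_⟩
  · rintro (_ | i)
    · exact ⟨(hasLocalEnd_toRep (.L₂ ⟨n, hn, le_rfl⟩)).indecomposable, isEpsInjective_L₂⟩
    · exact ⟨(hasLocalEnd_toRep (.L₃ i)).indecomposable, isEpsInjective_L₃ i⟩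
  · rintro (_ | i) (_ | j) ⟨e⟩
    · rfl
    · cases eq_of_iso_toRep (v := .L₂ ⟨n, hn, le_rfl⟩) (w := .L₃ j) e
    · cases eq_of_iso_toRep (v := .L₃ i) (w := .L₂ ⟨n, hn, le_rfl⟩) e
    · cases eq_of_iso_toRep (v := .L₃ i) (w := .L₃ j) e
      rfl
  · rintro V ⟨hV, hP⟩
    obtain ⟨_ | i | ⟨i, hi, hi'⟩ | i, ⟨e⟩⟩ := exists_iso_toRep hn hV
    · exact absurd (hP.of_iso e) (isAlmostSplit_seqS hn).not_isEpsInjective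
    · exact absurd (hP.of_iso e) (not_isEpsInjective_L₁ i)
    · rcases hi'.eq_or_lt with rfl | hlt
      · exact ⟨none, ⟨e⟩⟩
      · exact absurd (hP.of_iso e) (not_isEpsInjective_L₂ hi hlt)
    · exact ⟨some i, ⟨e⟩⟩

theorem isRepresentativeFamily_toRep (hn : 1 ≤ n) : IsRepresentativeFamily
    (fun V : InvRep k (UPoset n) => Indecomposable V) (Vertex.toRep (n := n) k) :=
  ⟨fun v => (hasLocalEnd_toRep v).indecomposable, fun _ _ ⟨e⟩ => eq_of_iso_toRep e,
    fun _ hV => exists_iso_toRep hn hV⟩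

/-! # The arrows -/

theorem mem_catRad_of_ne {v w : Vertex n} (h : v ≠ w) (f : v.toRep k ⟶ w.toRep k) :
    f ∈ catRad k (v.toRep k) (w.toRep k) :=
  mem_catRad_of_not_isSplitMono (hasLocalEnd_toRep v) (not_isSplitMono_of_ne h f)

theorem irrDim_of_leftAlmostSplit {v e : Vertex n} (f : v.toRep k ⟶ e.toRep k) (hve : v ≠ e)
    (hf : f ≠ 0) (hfac : ∀ ⦃Z : InvRep k (UPoset n)⦄ (h : v.toRep k ⟶ Z), ¬ IsSplitMono h →
      ∃ g, f ≫ g = h) (w : Vertex n) :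
    (w = e → irrDim k (v.toRep k) (w.toRep k) = 1) ∧
      (w ≠ e → irrDim k (v.toRep k) (w.toRep k) = 0) := by
  -- The two-component criterion is applied with the zero endomorphism of the source as a dummy
  -- second component.
  have hfac' : ∀ ⦃Z : InvRep k (UPoset n)⦄ (h : v.toRep k ⟶ Z), ¬ IsSplitMono h →
      ∃ (h₁ : e.toRep k ⟶ Z) (h₂ : v.toRep k ⟶ Z), f ≫ h₁ + (0 : v.toRep k ⟶ v.toRep k) ≫ h₂ = h :=
    fun Z h hh => by
      obtain ⟨g, rfl⟩ := hfac h hh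
      exact ⟨g, 0, by simp⟩
  have hrad := mem_catRad_of_ne hve f
  have h0 : ∀ {Y} (t : v.toRep k ⟶ Y), (0 : v.toRep k ⟶ v.toRep k) ≫ t ∈ catRadSq k _ _ :=
    fun t => by rw [zero_comp]; exact Submodule.zero_mem _
  refine ⟨?_, fun hw => ?_⟩
  · rintro rfl
    exact irrDim_eq_one_of_leftAlmostSplit (not_isZero_toRep v) hfac' hrad
      (fun t ht => hf (by rw [ht, zero_comp])) h0 (exists_smul_sub_mem_catRad w)
  · exact irrDim_eq_zero_of_leftAlmostSplit (not_isZero_toRep v) hfac'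
      (fun t => comp_mem_catRadSq hrad (mem_catRad_of_ne hw.symm t)) h0

theorem irrDim_L₃ (i : Set.Icc 1 n) (w : Vertex n) :
    (w = .L₁ i ∨ w = .L₂ i → irrDim k (L₃ k n i) (w.toRep k) = 1) ∧
      (w ≠ .L₁ i → w ≠ .L₂ i → irrDim k (L₃ k n i) (w.toRep k) = 0) := by
  have hfac := fun {Z} => exists_L₂fst_comp_add_L₁snd_comp (k := k) (V := Z) (i := i)
  have hz := not_isZero_toRep (k := k) (.L₃ i)
  have hr₁ := mem_catRad_of_ne (v := .L₃ i) (w := .L₁ i) (by simp) (L₁snd k n le_rfl)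
  have hr₂ := mem_catRad_of_ne (v := .L₃ i) (w := .L₂ i) (by simp) (L₂fst k n le_rfl)
  refine ⟨?_, fun h₁ h₂ => ?_⟩
  · rintro (rfl | rfl)
    · refine irrDim_eq_one_of_leftAlmostSplit (k := k) hz (fun Z h hh => ?_) hr₁ (fun t ht => ?_)
        (fun t => comp_mem_catRadSq hr₂ (mem_catRad_of_ne (v := .L₂ i) (w := .L₁ i) (by simp) t))
        (exists_smul_sub_mem_catRad (.L₁ i))
      · obtain ⟨a, b, e⟩ := hfac h hh
        exact ⟨b, a, by rw [add_comm]; exact e⟩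
      -- The two projections of 𝓛_{3,i} have different kernels, so neither factors through the
      -- other; evaluation at e₂ shows this here.
      · have h1 : (1 : k) = lin t (0 : k) := congrArg (fun f => lin f ((0, 1) : k × k)) ht
        exact one_ne_zero (α := k) (h1.trans (map_zero (lin t)))
    · refine irrDim_eq_one_of_leftAlmostSplit (k := k) hz (fun Z h hh => hfac h hh) hr₂
        (fun t ht => ?_)
        (fun t => comp_mem_catRadSq hr₁ (mem_catRad_of_ne (v := .L₁ i) (w := .L₂ i) (by simp) t))
        (exists_smul_sub_mem_catRad (.L₂ i))
      have h1 : (1 : k) = lin t (0 : k) := congrArg (fun f => lin f ((1, 0) : k × k)) ht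
      exact one_ne_zero (α := k) (h1.trans (map_zero (lin t)))
  · exact irrDim_eq_zero_of_leftAlmostSplit (k := k) hz (fun Z h hh => hfac h hh)
      (fun t => comp_mem_catRadSq hr₂ (mem_catRad_of_ne h₂.symm t))
      (fun t => comp_mem_catRadSq hr₁ (mem_catRad_of_ne h₁.symm t))

theorem ne_zero_of_injective {V W : InvRep k (UPoset n)} {f : V ⟶ W} (hV : ¬ IsZero V)
    (hf : Function.Injective (lin f)) : f ≠ 0 := by
  rintro rfl
  exact hV (isZero_iff.2 fun x => hf (map_zero (lin (0 : V ⟶ W))).symm)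

theorem irrDim_toRep (hn : 1 ≤ n) (v w : Vertex n) :
    (v.Arrow w → irrDim k (v.toRep k) (w.toRep k) = 1) ∧
      (¬ v.Arrow w → irrDim k (v.toRep k) (w.toRep k) = 0) := by
  have key : ∀ {e : Vertex n} (f : v.toRep k ⟶ e.toRep k), v ≠ e → Function.Injective (lin f) →
      (∀ ⦃Z : InvRep k (UPoset n)⦄ (h : v.toRep k ⟶ Z), ¬ IsSplitMono h → ∃ g, f ≫ g = h) →
      (v.Arrow w ↔ w = e) → (v.Arrow w → irrDim k (v.toRep k) (w.toRep k) = 1) ∧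
        (¬ v.Arrow w → irrDim k (v.toRep k) (w.toRep k) = 0) := fun f hne hf hfac hA => by
    rw [hA]
    exact irrDim_of_leftAlmostSplit f hne (ne_zero_of_injective (not_isZero_toRep v) hf) hfac w
  rcases v with _ | ⟨i, hi, hi'⟩ | ⟨i, hi, hi'⟩ | i
  · refine key (e := .L₃ ⟨n, hn, le_rfl⟩) (Sinr k n n) (by simp) (inr_injective k)
      (fun Z h hh => exists_Sinr_comp (j := ⟨n, hn, le_rfl⟩) rfl h hh) ?_
    cases w <;> simp [Vertex.Arrow, Subtype.ext_iff]
  · obtain _ | _ | i := i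
    · omega
    · refine key (e := .L₃ ⟨1, hi, hi'⟩) (L₁inl k n 1 1) (by simp) (inl_injective k)
        (fun Z h hh => exists_L₁inl_comp (i := ⟨1, hi, hi'⟩) rfl h hh) ?_
      rcases w with _ | j | j | ⟨j, hj, hj'⟩ <;> simp [Vertex.Arrow, Subtype.ext_iff]
      omega
    · refine key (e := .L₃ ⟨i + 1, by omega, by omega⟩) (L₁inr k n (i + 1).lt_succ_self) (by simp)
        (inr_injective k)
        (fun Z h hh => exists_L₁inr_comp (i := ⟨i + 1 + 1, hi, hi'⟩)
          (j := ⟨i + 1, by omega, by omega⟩) rfl (i + 1).lt_succ_self h hh) ?_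
      rcases w with _ | j | j | ⟨j, hj, hj'⟩ <;> simp [Vertex.Arrow, Subtype.ext_iff]
      omega
  · rcases hi'.eq_or_lt with rfl | hlt
    -- No arrow starts at 𝓛_{2,n}: a nonzero morphism from it splits, so its radical morphisms
    -- vanish.
    · have hA : ¬ (Vertex.L₂ ⟨i, hi, hi'⟩).Arrow w := by
        rcases w with _ | j | j | ⟨j, hj, hj'⟩ <;> simp [Vertex.Arrow]
        omega
      refine ⟨fun h => absurd h hA, fun _ => irrDim_eq_zero_of_le fun f hf => ?_⟩
      rw [eq_zero_of_not_isSplitMono (i := ⟨i, hi, hi'⟩) rfl f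
        (not_isSplitMono_of_mem_catRad (not_isZero_toRep (.L₂ ⟨i, hi, hi'⟩)) hf)]
      exact Submodule.zero_mem _
    · refine key (e := .L₃ ⟨i + 1, by omega, hlt⟩) (L₂inl k n i.lt_succ_self) (by simp)
        (inl_injective k)
        (fun Z h hh => exists_L₂inl_comp (i := ⟨i, hi, hi'⟩)
          (j := ⟨i + 1, by omega, hlt⟩) rfl i.lt_succ_self h hh) ?_
      cases w <;> simp [Vertex.Arrow, Subtype.ext_iff]
  · have hA : (Vertex.L₃ i).Arrow w ↔ w = .L₁ i ∨ w = .L₂ i := by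
      cases w <;> simp [Vertex.Arrow, eq_comm]
    rw [hA, not_or]
    exact ⟨(irrDim_L₃ i w).1, fun h => (irrDim_L₃ i w).2 h.1 h.2⟩

/-! # The translation -/

theorem exists_isAlmostSplit_iff (hn : 1 ≤ n) (v w : Vertex n) :
    (∃ T : ShortComplex (InvRep k (UPoset n)), IsAlmostSplit T ∧
      Nonempty (T.X₁ ≅ v.toRep k) ∧ Nonempty (T.X₃ ≅ w.toRep k)) ↔ v.IsTranslateOf w := by
  constructor
  · rintro ⟨T, hT, ⟨e₁⟩, ⟨e₃⟩⟩
    have key : ∀ {T' : ShortComplex (InvRep k (UPoset n))} {v' w' : Vertex n}, (T ≅ T') →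
        T'.X₁ = v'.toRep k → T'.X₃ = w'.toRep k → v = v' ∧ w = w' := fun t h₁ h₃ =>
      ⟨eq_of_iso_toRep (e₁.symm ≪≫ ShortComplex.π₁.mapIso t ≪≫ eqToIso h₁),
        eq_of_iso_toRep (e₃.symm ≪≫ ShortComplex.π₃.mapIso t ≪≫ eqToIso h₃)⟩
    obtain ⟨⟨t⟩⟩ | ⟨i, hi, hi', ⟨t⟩⟩ | ⟨i, hi, hi', ⟨t⟩⟩ | ⟨⟨t⟩⟩ := iso_of_isAlmostSplit hn hT
    · obtain ⟨rfl, rfl⟩ := key (v' := .L₁ ⟨1, le_rfl, hn⟩) (w' := .L₁ ⟨1, le_rfl, hn⟩) t rfl rfl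
      exact ⟨rfl, rfl⟩
    · obtain ⟨rfl, rfl⟩ := key (v' := .L₁ ⟨i + 1, by omega, hi'⟩)
        (w' := .L₂ ⟨i, hi, by omega⟩) t rfl rfl
      exact rfl
    · obtain ⟨rfl, rfl⟩ := key (v' := .L₂ ⟨i, hi, by omega⟩)
        (w' := .L₁ ⟨i + 1, by omega, hi'⟩) t rfl rfl
      exact rfl
    · obtain ⟨rfl, rfl⟩ := key (v' := .S) (w' := .L₂ ⟨n, hn, le_rfl⟩) t rfl rfl
      exact rfl
  · intro h
    rcases v with _ | ⟨i, hi, hi'⟩ | ⟨i, hi, hi'⟩ | i <;>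
      rcases w with _ | ⟨j, hj, hj'⟩ | ⟨j, hj, hj'⟩ | j <;> try exact h.elim
    · obtain rfl : j = n := h
      exact ⟨_, isAlmostSplit_seqS hn, ⟨Iso.refl _⟩, ⟨Iso.refl _⟩⟩
    · obtain ⟨rfl, rfl⟩ : i = 1 ∧ j = 1 := h
      exact ⟨_, isAlmostSplit_seq₁₁ hn, ⟨Iso.refl _⟩, ⟨Iso.refl _⟩⟩
    · obtain rfl : i = j + 1 := h
      exact ⟨_, isAlmostSplit_seq₁₂ hj hi', ⟨Iso.refl _⟩, ⟨Iso.refl _⟩⟩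
    · obtain rfl : j = i + 1 := h
      exact ⟨_, isAlmostSplit_seq₂₁ hi hj', ⟨Iso.refl _⟩, ⟨Iso.refl _⟩⟩

end UPoset

theorem theorem2 (k : Type u) [Field k] [IsAlgClosed k] (n : ℕ) (hn : 1 ≤ n) :
    -- indecomposable projectives: `S` and the `𝓛_{3,r}`
    InvRep.IsRepresentativeFamily
      (fun V : InvRep k (UPoset n) => Indecomposable V ∧ V.IsEpsProjective)
      (fun r : Option (Set.Icc 1 n) => r.elim (UPoset.S k n) (fun r => UPoset.L₃ k n r)) ∧
    -- indecomposable injectives: `𝓛_{2,n}` and the `𝓛_{3,r}`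
    InvRep.IsRepresentativeFamily
      (fun V : InvRep k (UPoset n) => Indecomposable V ∧ V.IsEpsInjective)
      (fun r : Option (Set.Icc 1 n) => r.elim (UPoset.L₂ k n n) (fun r => UPoset.L₃ k n r)) ∧
    -- the listed sequences are almost split
    (InvRep.IsAlmostSplit (UPoset.seq₁₁ k n) ∧
      (∀ i, 1 ≤ i → i + 1 ≤ n → InvRep.IsAlmostSplit (UPoset.seq₁₂ k n i)) ∧
      (∀ i, 1 ≤ i → i + 1 ≤ n → InvRep.IsAlmostSplit (UPoset.seq₂₁ k n i)) ∧
      InvRep.IsAlmostSplit (UPoset.seqS k n)) ∧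
    -- every almost split sequence is isomorphic to a listed one
    (∀ T : ShortComplex (InvRep k (UPoset n)), InvRep.IsAlmostSplit T →
      Nonempty (T ≅ UPoset.seq₁₁ k n) ∨
      (∃ i, 1 ≤ i ∧ i + 1 ≤ n ∧ Nonempty (T ≅ UPoset.seq₁₂ k n i)) ∨
      (∃ i, 1 ≤ i ∧ i + 1 ≤ n ∧ Nonempty (T ≅ UPoset.seq₂₁ k n i)) ∨
      Nonempty (T ≅ UPoset.seqS k n)) ∧
    -- the Auslander–Reiten quiver: vertices, arrows (all simple), translation
    InvRep.IsRepresentativeFamily (fun V : InvRep k (UPoset n) => Indecomposable V)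
      (UPoset.Vertex.toRep k) ∧
    (∀ v w : UPoset.Vertex n,
      (v.Arrow w → irrDim k (v.toRep k) (w.toRep k) = 1) ∧
      (¬ v.Arrow w → irrDim k (v.toRep k) (w.toRep k) = 0)) ∧
    (∀ v w : UPoset.Vertex n,
      (∃ T : ShortComplex (InvRep k (UPoset n)), InvRep.IsAlmostSplit T ∧
        Nonempty (T.X₁ ≅ v.toRep k) ∧ Nonempty (T.X₃ ≅ w.toRep k)) ↔ v.IsTranslateOf w) := by
  exact ⟨UPoset.isRepresentativeFamily_projective hn, UPoset.isRepresentativeFamily_injective hn,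
    ⟨UPoset.isAlmostSplit_seq₁₁ hn, fun _ hi hi' => UPoset.isAlmostSplit_seq₁₂ hi hi',
      fun _ hi hi' => UPoset.isAlmostSplit_seq₂₁ hi hi', UPoset.isAlmostSplit_seqS hn⟩,
    fun _ hT => UPoset.iso_of_isAlmostSplit hn hT, UPoset.isRepresentativeFamily_toRep hn,
    UPoset.irrDim_toRep hn, UPoset.exists_isAlmostSplit_iff hn⟩
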